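/- Let $K$ be a field of arbitrary characteristic, let $m \ge 1$ and $1 \le i \le n$ be integers, and let $A = K[x_1,\dots,x_n]$ with its standard grading $\deg x_k = 1$. (In particular, this covers the case where $K$ has characteristic $p > 0$, $n \ge 1$ and $n \equiv i \pmod p$ with $0 < i < p$, since then $1 \le i \le n$.) Let $J' \subset A$ be the ideal generated by $e_1(x_1^m,\dots,x_n^m), \dots, e_n(x_1^m,\dots,x_n^m)$, where $e_1,\dots,e_n$ are the elementary symmetric polynomials in $n$ variables, together with all squarefree monomials of degree $i$ in $x_1,\dots,x_n$. This is a homogeneous ideal, and the Hilbert series $\sum_{d\ge 0} \dim_K (A/J')_d\, t^d$ of $A/J'$ is \[ \left(\sum_{j=0}^{i-1} \binom{n-i+j}{n-i} t^j\right) \cdot \prod_{j=1}^{i-1} \frac{1-t^{jm}}{1-t}. \] The socle of $A/J'$ (the sum of all simple $A$-submodules of $A/J'$) is concentrated in top degree, that is, it is contained in $(A/J')_D$, where $D$ is the largest degree with $(A/J')_D \ne 0$. The dimension of the socle over $K$ is $\binom{n-1}{i-1}$. -/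

import Mathlib

open scoped PowerSeries

/-- The ideal `J'` of `A = K[x_1, …, x_n]` generated by the elementary symmetric polynomials
`e_1, …, e_n` evaluated at `x_1 ^ m, …, x_n ^ m` and by all squarefree monomials of degree `i`. -/
noncomputable def idealJ' (K : Type*) [Field K] (n m i : ℕ) : Ideal (MvPolynomial (Fin n) K) :=
  Ideal.span
    ({f | ∃ j ∈ Finset.Icc 1 n,
        f = MvPolynomial.aeval (fun k : Fin n => (MvPolynomial.X k : MvPolynomial (Fin n) K) ^ m)
          (MvPolynomial.esymm (Fin n) K j)} ∪
     {f | ∃ S : Finset (Fin n), S.card = i ∧ f = ∏ k ∈ S, MvPolynomial.X k})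

/-- `J'` is a homogeneous ideal for the standard grading (every variable has degree `1`), so that
`A / J'` is a graded ring. -/
theorem idealJ'_isHomogeneous (K : Type*) [Field K] (n m i : ℕ) :
    letI := MvPolynomial.gradedAlgebra (σ := Fin n) (R := K)
    (idealJ' K n m i).IsHomogeneous (MvPolynomial.homogeneousSubmodule (Fin n) K) := by
  let _ := MvPolynomial.gradedAlgebra (σ := Fin n) (R := K)
  refine Ideal.homogeneous_span _ _ ?_
  rintro f (⟨j, -, rfl⟩ | ⟨S, -, rfl⟩)
  · refine ⟨m * j, ?_⟩
    rw [MvPolynomial.mem_homogeneousSubmodule, MvPolynomial.esymm, map_sum]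
    refine MvPolynomial.IsHomogeneous.sum _ _ _ fun S hS => ?_
    rw [map_prod]
    have h : ∑ _k ∈ S, m = m * j := by
      rw [Finset.sum_const, (Finset.mem_powersetCard.mp hS).2, smul_eq_mul, mul_comm]
    rw [← h]
    refine MvPolynomial.IsHomogeneous.prod S _ _ fun k _ => ?_
    rw [MvPolynomial.aeval_X]
    exact MvPolynomial.isHomogeneous_X_pow k m
  · refine ⟨∑ k ∈ S, 1, ?_⟩
    rw [MvPolynomial.mem_homogeneousSubmodule]
    exact MvPolynomial.IsHomogeneous.prod S _ _ (fun k _ => MvPolynomial.isHomogeneous_X K k)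

/-- The degree `d` component of the quotient `A / I` of the polynomial ring `A = K[x_1, …, x_n]` by
a homogeneous ideal `I`: the image of the homogeneous polynomials of degree `d`. -/
noncomputable def gradedPart {K : Type*} [Field K] {n : ℕ} (I : Ideal (MvPolynomial (Fin n) K))
    (d : ℕ) : Submodule K (MvPolynomial (Fin n) K ⧸ I) :=
  (MvPolynomial.homogeneousSubmodule (Fin n) K d).map (Ideal.Quotient.mkₐ K I).toLinearMap

/-- The graded components are finite-dimensional, so that their `finrank` is their dimension. -/
instance gradedPart_finite {K : Type*} [Field K] {n : ℕ} (I : Ideal (MvPolynomial (Fin n) K))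
    (d : ℕ) : Module.Finite K (gradedPart I d) :=
  Module.Finite.iff_fg.mpr ((MvPolynomial.homogeneousSubmodule_fg (Fin n) K d).map _)

/-- The Hilbert series `∑_d dim_K (A / I)_d t^d` of the quotient of the polynomial ring by a
homogeneous ideal. -/
noncomputable def hilbertSeries {K : Type*} [Field K] {n : ℕ}
    (I : Ideal (MvPolynomial (Fin n) K)) : ℚ⟦X⟧ :=
  PowerSeries.mk fun d => (Module.finrank K (gradedPart I d) : ℚ)

/-- The socle of a module: the sum of its simple submodules. -/
def moduleSocle (R M : Type*) [Ring R] [AddCommGroup M] [Module R M] : Submodule R M :=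
  sSup {S : Submodule R M | IsSimpleModule R S}

/-! Write J(s, r) for `symmIdeal K m sᶜ s s r` and H for Hilbert series of quotients. For a in s,
multiplication by x_a gives 0 → A/(J : x_a)(-1) → A/J → A/(J + x_a) → 0. The right end is a quotient
of A/J(s \ a, r). The left end is a quotient of A/L, where L = `symmIdeal K m sᶜ (s.erase a) s (r -
1)` contains x_a^((r-1)m) and L + (x_a) contains J(s \ a, r - 1). By induction H(J) is at most the
recursive series `symmSeries` (`hilbertSeries_symmIdeal_le`).

For the opposite bound, the same recursion applied to the squarefree monomial ideal alone shows that
its series is at least `symmSeries` divided by the product of the 1 - t^(jm), 1 ≤ j < r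
(`le_hilbertSeries_squarefreeIdeal`). Adding forms of degrees m, ..., (r-1)m lowers a series at most
as a regular sequence would (`hilbertSeries_le_prod_mul`). The two bounds meet in
`hilbertSeries_symmIdeal`; regularity is never checked and the characteristic plays no role.

Sharpness turns the inclusions above into equalities (`symmIdeal_exact`), so the socle can be
followed through the exact sequence: both ends have their socle in the same degree of A/J
(`socleInDegree_symmIdeal`). The induction starts at |s| = r, where J = C + (p) with C generated by
the elementary symmetric polynomials and the variables outside s, p the product of the variables in
s, and p^m in C; multiplication by p^(m-1) embeds A/J in A/C. The socle is then the top component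
(`moduleSocle_eq_gradedPart`), and its dimension is the last coefficient of the series
(`coeff_symmSeries`). -/

/-! ### Coefficientwise inequalities between power series -/

/-- Coefficientwise order on power series. -/
def CoeffLE (f g : ℚ⟦X⟧) : Prop := ∀ d, PowerSeries.coeff d f ≤ PowerSeries.coeff d g

namespace CoeffLE

variable {f g k l : ℚ⟦X⟧}

theorem refl (f : ℚ⟦X⟧) : CoeffLE f f := fun _ => le_rfl

theorem trans (h : CoeffLE f g) (h' : CoeffLE g k) : CoeffLE f k := fun d => (h d).trans (h' d)

theorem antisymm (h : CoeffLE f g) (h' : CoeffLE g f) : f = g :=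
  PowerSeries.ext fun d => le_antisymm (h d) (h' d)

theorem add (h : CoeffLE f g) (h' : CoeffLE k l) : CoeffLE (f + k) (g + l) := fun d => by
  simpa using add_le_add (h d) (h' d)

theorem mul_nonneg (h : CoeffLE 0 f) (h' : CoeffLE 0 g) : CoeffLE 0 (f * g) := fun d => by
  rw [PowerSeries.coeff_mul]
  exact Finset.sum_nonneg fun p _ => _root_.mul_nonneg (by simpa using h p.1) (by simpa using h' p.2)

theorem mul_left (hk : CoeffLE 0 k) (h : CoeffLE f g) : CoeffLE (k * f) (k * g) := fun d => by
  rw [PowerSeries.coeff_mul, PowerSeries.coeff_mul]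
  exact Finset.sum_le_sum fun p _ => mul_le_mul_of_nonneg_left (h p.2) (by simpa using hk p.1)

theorem zero_X_pow (n : ℕ) : CoeffLE 0 (PowerSeries.X ^ n) := fun d => by
  rw [PowerSeries.coeff_X_pow]; split_ifs <;> simp

theorem zero_one : CoeffLE 0 1 := by simpa using zero_X_pow 0

theorem zero_sum {ι : Type*} (s : Finset ι) (f : ι → ℚ⟦X⟧) (h : ∀ i ∈ s, CoeffLE 0 (f i)) :
    CoeffLE 0 (∑ i ∈ s, f i) := fun d => by
  rw [map_sum]
  exact Finset.sum_nonneg fun i hi => by simpa using h i hi d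

theorem zero_prod {ι : Type*} (s : Finset ι) (f : ι → ℚ⟦X⟧) (h : ∀ i ∈ s, CoeffLE 0 (f i)) :
    CoeffLE 0 (∏ i ∈ s, f i) :=
  Finset.prod_induction f (CoeffLE 0) (fun _ _ => mul_nonneg) zero_one h

/-- Makes the bounds at both ends of an exact sequence sharp once the bound in the middle is. -/
theorem eq_of_add_eq (h : CoeffLE f g) (h' : CoeffLE k l) (e : f + k = g + l) : f = g ∧ k = l := by
  constructor <;> ext d <;>
  · have := congrArg (PowerSeries.coeff d) e
    simp only [map_add] at this
    linarith [h d, h' d]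

/-- A coefficientwise bound is sharp once it is after multiplication by a nonnegative series with
constant term one. -/
theorem eq_of_mul_right (h : CoeffLE f g) (hk : CoeffLE 0 k) (hk1 : PowerSeries.coeff 0 k = 1)
    (h' : CoeffLE (g * k) (f * k)) : f = g := by
  refine antisymm h fun d => ?_
  have h1 := h' d
  rw [PowerSeries.coeff_mul, PowerSeries.coeff_mul, ← sub_nonneg, ← Finset.sum_sub_distrib] at h1
  -- All terms of the sum are nonnegative, and the one at `(d, 0)` is the difference of the `d`-th
  -- coefficients of `g` and `f`, because `k` has constant term one.
  have h2 := Finset.sum_le_sum_of_subset_of_nonneg (f := fun p : ℕ × ℕ =>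
      PowerSeries.coeff p.1 g * PowerSeries.coeff p.2 k -
        PowerSeries.coeff p.1 f * PowerSeries.coeff p.2 k)
    (s := {(d, 0)}) (t := Finset.HasAntidiagonal.antidiagonal d) (by simp) (fun p _ _ => by
      have := mul_le_mul_of_nonneg_right (h p.1) (by simpa using hk p.2)
      linarith)
  simp only [Finset.sum_singleton, hk1, mul_one] at h2
  have h3 : ∑ p ∈ Finset.HasAntidiagonal.antidiagonal d, (PowerSeries.coeff p.1 g * PowerSeries.coeff p.2 k -
        PowerSeries.coeff p.1 f * PowerSeries.coeff p.2 k) =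
      -∑ p ∈ Finset.HasAntidiagonal.antidiagonal d, (PowerSeries.coeff p.1 f * PowerSeries.coeff p.2 k -
        PowerSeries.coeff p.1 g * PowerSeries.coeff p.2 k) := by
    rw [← Finset.sum_neg_distrib]
    exact Finset.sum_congr rfl fun p _ => by ring
  linarith

end CoeffLE

/-! ### Finite and infinite geometric series -/

/-- The finite geometric series `1 + t ^ k + ⋯ + t ^ (k (N - 1))`. -/
noncomputable def geomSeries (k N : ℕ) : ℚ⟦X⟧ := ∑ j ∈ Finset.range N, PowerSeries.X ^ (k * j)

theorem geomSeries_succ (k N : ℕ) :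
    geomSeries k (N + 1) = 1 + PowerSeries.X ^ k * geomSeries k N := by
  rw [geomSeries, Finset.sum_range_succ', geomSeries, Finset.mul_sum, add_comm]
  congr 1
  exact Finset.sum_congr rfl fun j _ => by rw [← pow_add]; ring_nf

theorem zero_le_geomSeries (k N : ℕ) : CoeffLE 0 (geomSeries k N) :=
  CoeffLE.zero_sum _ _ fun _ _ => CoeffLE.zero_X_pow _

theorem geomSeries_mul_one_sub (k N : ℕ) :
    geomSeries k N * (1 - PowerSeries.X ^ k) = 1 - PowerSeries.X ^ (k * N) := by
  simp_rw [geomSeries, pow_mul]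
  rw [← neg_sub, mul_neg, geom_sum_mul, neg_sub]

theorem one_sub_X_pow_ne_zero {k : ℕ} (hk : k ≠ 0) : (1 - PowerSeries.X ^ k : ℚ⟦X⟧) ≠ 0 := by
  intro h
  have := congrArg (PowerSeries.coeff 0) h
  simp [hk] at this

theorem geomSeries_mul (k a b : ℕ) :
    geomSeries k (a * b) = geomSeries k a * geomSeries (k * a) b := by
  rcases Nat.eq_zero_or_pos k with rfl | hk
  · simp [geomSeries]
  · refine mul_right_cancel₀ (one_sub_X_pow_ne_zero hk.ne') ?_
    linear_combination geomSeries_mul_one_sub k (a * b) -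
      geomSeries (k * a) b * geomSeries_mul_one_sub k a - geomSeries_mul_one_sub (k * a) b

theorem geomSeries_ne_zero (k : ℕ) {N : ℕ} (hN : N ≠ 0) : geomSeries k N ≠ 0 := by
  obtain ⟨N, rfl⟩ := Nat.exists_eq_succ_of_ne_zero hN
  rcases Nat.eq_zero_or_pos k with rfl | hk
  · intro h
    have := congrArg (PowerSeries.coeff 0) h
    simp [geomSeries] at this
    norm_cast at this
  · intro h
    have h1 := geomSeries_mul_one_sub k (N + 1)
    rw [Nat.succ_eq_add_one] at h
    rw [h, zero_mul] at h1
    exact one_sub_X_pow_ne_zero (Nat.mul_pos hk N.succ_pos).ne' h1.symm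

/-- The infinite geometric series `1 / (1 - t ^ k)`. -/
noncomputable def geomInv (k : ℕ) : ℚ⟦X⟧ := (1 - PowerSeries.X ^ k)⁻¹

theorem one_sub_mul_geomInv {k : ℕ} (hk : k ≠ 0) : (1 - PowerSeries.X ^ k) * geomInv k = 1 :=
  PowerSeries.mul_inv_cancel _ (by simp [hk])

theorem geomInv_eq {k : ℕ} (hk : k ≠ 0) : geomInv k = 1 + PowerSeries.X ^ k * geomInv k := by
  linear_combination one_sub_mul_geomInv hk

theorem coeff_zero_geomInv {k : ℕ} (hk : k ≠ 0) : PowerSeries.coeff 0 (geomInv k) = 1 := by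
  rw [geomInv_eq hk]
  simp [hk]

theorem zero_le_geomInv {k : ℕ} (hk : k ≠ 0) : CoeffLE 0 (geomInv k) := by
  intro d
  induction d using Nat.strong_induction_on with
  | _ d ih =>
    rw [geomInv_eq hk, map_add, PowerSeries.coeff_X_pow_mul']
    have h1 := CoeffLE.zero_one d
    simp only [map_zero] at h1 ih ⊢
    split_ifs with h
    · have := ih (d - k) (by omega)
      linarith
    · linarith

/-- The hypothesis says (1 - t^k) f ≤ g, and multiplying by 1/(1 - t^k) keeps the order because its
coefficients are nonnegative. -/
theorem CoeffLE.geomInv_mul {f g : ℚ⟦X⟧} {k : ℕ} (hk : k ≠ 0)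
    (h : CoeffLE f (g + PowerSeries.X ^ k * f)) : CoeffLE f (geomInv k * g) := by
  have h1 : CoeffLE ((1 - PowerSeries.X ^ k) * f) g := fun d => by
    have := h d
    simp only [sub_mul, one_mul, map_sub, map_add] at this ⊢
    linarith
  have h2 := CoeffLE.mul_left (zero_le_geomInv hk) h1
  rwa [← mul_assoc, mul_comm (geomInv k) (1 - _), one_sub_mul_geomInv hk, one_mul] at h2

theorem CoeffLE.geomInv_mul' {f g : ℚ⟦X⟧} {k : ℕ} (hk : k ≠ 0)
    (h : CoeffLE (g + PowerSeries.X ^ k * f) f) : CoeffLE (geomInv k * g) f := by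
  have h1 : CoeffLE g ((1 - PowerSeries.X ^ k) * f) := fun d => by
    have := h d
    simp only [sub_mul, one_mul, map_sub, map_add] at this ⊢
    linarith
  have h2 := CoeffLE.mul_left (zero_le_geomInv hk) h1
  rwa [← mul_assoc, mul_comm (geomInv k) (1 - _), one_sub_mul_geomInv hk, one_mul] at h2

/-! ### Hilbert series, colon ideals and multiplication by a form -/

section Graded

variable {K : Type*} [Field K] {n : ℕ}

local notation "A" => MvPolynomial (Fin n) K

/-- Ideals closed under taking homogeneous components. -/
def HomIdeal (I : Ideal (MvPolynomial (Fin n) K)) : Prop :=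
  ∀ f ∈ I, ∀ e, MvPolynomial.homogeneousComponent e f ∈ I

theorem homogeneousComponent_mul_of_isHomogeneous {f g : A} {k : ℕ} (hf : f.IsHomogeneous k)
    (e : ℕ) : MvPolynomial.homogeneousComponent (k + e) (f * g) =
      f * MvPolynomial.homogeneousComponent e g := by
  conv_lhs => rw [← MvPolynomial.sum_homogeneousComponent g, Finset.mul_sum, map_sum]
  have h : ∀ j, MvPolynomial.homogeneousComponent (k + e)
      (f * MvPolynomial.homogeneousComponent j g) =
      if j = e then f * MvPolynomial.homogeneousComponent j g else 0 := fun j => by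
    rw [MvPolynomial.homogeneousComponent_of_mem
      (hf.mul (MvPolynomial.homogeneousComponent_isHomogeneous j g))]
    simp [eq_comm]
  simp_rw [h]
  rw [Finset.sum_ite_eq']
  split_ifs with h'
  · rfl
  · rw [MvPolynomial.homogeneousComponent_eq_zero, mul_zero]
    simpa using h'

theorem homogeneousComponent_mul_of_lt {f g : A} {k e : ℕ} (hf : f.IsHomogeneous k) (he : e < k) :
    MvPolynomial.homogeneousComponent e (f * g) = 0 := by
  conv_lhs => rw [← MvPolynomial.sum_homogeneousComponent g, Finset.mul_sum, map_sum]
  refine Finset.sum_eq_zero fun j _ => ?_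
  rw [MvPolynomial.homogeneousComponent_of_mem
      (hf.mul (MvPolynomial.homogeneousComponent_isHomogeneous j g)), if_neg (by omega)]

theorem HomIdeal.sup {I I' : Ideal A} (h : HomIdeal I) (h' : HomIdeal I') : HomIdeal (I ⊔ I') := by
  intro f hf e
  obtain ⟨a, ha, b, hb, rfl⟩ := Submodule.mem_sup.mp hf
  rw [map_add]
  exact add_mem (Ideal.mem_sup_left (h a ha e)) (Ideal.mem_sup_right (h' b hb e))

theorem homIdeal_span {S : Set A} (hS : ∀ f ∈ S, ∃ k, f.IsHomogeneous k) :
    HomIdeal (Ideal.span S) := by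
  intro f hf e
  induction hf using Submodule.span_induction generalizing e with
  | mem f hf =>
    obtain ⟨k, hk⟩ := hS f hf
    rw [MvPolynomial.homogeneousComponent_of_mem hk]
    split_ifs
    · exact Ideal.subset_span hf
    · exact zero_mem _
  | zero => simp
  | add f g _ _ hf hg => rw [map_add]; exact add_mem (hf e) (hg e)
  | smul a f _ hf =>
    rw [smul_eq_mul, mul_comm]
    conv => enter [2]; rw [← MvPolynomial.sum_homogeneousComponent f, Finset.sum_mul, map_sum]
    refine sum_mem fun j _ => ?_
    rcases le_or_gt j e with h | h
    · obtain ⟨e, rfl⟩ := Nat.exists_eq_add_of_le h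
      rw [homogeneousComponent_mul_of_isHomogeneous
        (MvPolynomial.homogeneousComponent_isHomogeneous j f)]
      exact Ideal.mul_mem_right _ _ (hf j)
    · rw [homogeneousComponent_mul_of_lt
        (MvPolynomial.homogeneousComponent_isHomogeneous j f) h]
      exact zero_mem _

theorem homIdeal_span_singleton {f : A} {k : ℕ} (hf : f.IsHomogeneous k) :
    HomIdeal (Ideal.span {f}) :=
  homIdeal_span fun g hg => ⟨k, by rwa [Set.mem_singleton_iff.mp hg]⟩

/-- The ideal quotient `I : f`. -/
def colonBy {R : Type*} [CommRing R] (I : Ideal R) (f : R) : Ideal R :=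
  Submodule.comap (LinearMap.mulLeft R f) I

theorem mem_colonBy {R : Type*} [CommRing R] {I : Ideal R} {f g : R} :
    g ∈ colonBy I f ↔ f * g ∈ I := Iff.rfl

theorem le_colonBy {R : Type*} [CommRing R] (I : Ideal R) (f : R) : I ≤ colonBy I f :=
  fun _ hg => Ideal.mul_mem_left _ _ hg

theorem HomIdeal.colonBy {I : Ideal A} (h : HomIdeal I) {f : A} {k : ℕ} (hf : f.IsHomogeneous k) :
    HomIdeal (colonBy I f) := by
  intro g hg e
  rw [mem_colonBy] at hg ⊢
  rw [← homogeneousComponent_mul_of_isHomogeneous hf]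
  exact h _ hg _

theorem mem_gradedPart_iff {I : Ideal A} {d : ℕ} {q : A ⧸ I} :
    q ∈ gradedPart I d ↔ ∃ f : A, f.IsHomogeneous d ∧ Ideal.Quotient.mk I f = q := by
  simp [gradedPart, Submodule.mem_map]

/-- The rank of the graded component is the codimension of the homogeneous elements of `I`. -/
theorem finrank_gradedPart_add (I : Ideal A) (d : ℕ) :
    Module.finrank K (gradedPart I d) +
      Module.finrank K (LinearMap.ker ((Ideal.Quotient.mkₐ K I).toLinearMap.domRestrict
        (MvPolynomial.homogeneousSubmodule (Fin n) K d))) =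
    Module.finrank K (MvPolynomial.homogeneousSubmodule (Fin n) K d) := by
  have : Module.Finite K (MvPolynomial.homogeneousSubmodule (Fin n) K d) :=
    Module.Finite.iff_fg.mpr (MvPolynomial.homogeneousSubmodule_fg (Fin n) K d)
  rw [← LinearMap.finrank_range_add_finrank_ker ((Ideal.Quotient.mkₐ K I).toLinearMap.domRestrict
        (MvPolynomial.homogeneousSubmodule (Fin n) K d)), LinearMap.range_domRestrict]
  rfl

theorem finrank_gradedPart_mono {I I' : Ideal A} (h : I ≤ I') (d : ℕ) :
    Module.finrank K (gradedPart I' d) ≤ Module.finrank K (gradedPart I d) := by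
  have h1 : gradedPart I' d = (gradedPart I d).map (Ideal.Quotient.factorₐ K h).toLinearMap := by
    rw [gradedPart, gradedPart, ← Submodule.map_comp]
    rfl
  rw [h1]
  exact Submodule.finrank_map_le _ _

theorem mem_of_finrank_gradedPart_le {I I' : Ideal A} (h : I ≤ I') {d : ℕ}
    (hd : Module.finrank K (gradedPart I d) ≤ Module.finrank K (gradedPart I' d)) {f : A}
    (hf : f.IsHomogeneous d) (hfI : f ∈ I') : f ∈ I := by
  have : Module.Finite K (MvPolynomial.homogeneousSubmodule (Fin n) K d) :=
    Module.Finite.iff_fg.mpr (MvPolynomial.homogeneousSubmodule_fg (Fin n) K d)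
  have h1 := finrank_gradedPart_add I d
  have h2 := finrank_gradedPart_add I' d
  have h3 : LinearMap.ker ((Ideal.Quotient.mkₐ K I).toLinearMap.domRestrict
        (MvPolynomial.homogeneousSubmodule (Fin n) K d)) ≤
      LinearMap.ker ((Ideal.Quotient.mkₐ K I').toLinearMap.domRestrict
        (MvPolynomial.homogeneousSubmodule (Fin n) K d)) := by
    intro x hx
    have hx' : Ideal.Quotient.mk I (x : A) = 0 := hx
    have : Ideal.Quotient.mk I' (x : A) = 0 :=
      Ideal.Quotient.eq_zero_iff_mem.mpr (h (Ideal.Quotient.eq_zero_iff_mem.mp hx'))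
    exact this
  have h4 := Submodule.eq_of_le_of_finrank_le h3 (by omega)
  have h5 : (⟨f, hf⟩ : MvPolynomial.homogeneousSubmodule (Fin n) K d) ∈
      LinearMap.ker ((Ideal.Quotient.mkₐ K I').toLinearMap.domRestrict
        (MvPolynomial.homogeneousSubmodule (Fin n) K d)) := by
    have : Ideal.Quotient.mk I' f = 0 := Ideal.Quotient.eq_zero_iff_mem.mpr hfI
    exact this
  rw [← h4] at h5
  have h6 : Ideal.Quotient.mk I f = 0 := h5
  exact Ideal.Quotient.eq_zero_iff_mem.mp h6

/-- Exactness of 0 → A/(I : f)(-k) → A/I → A/(I + f) → 0 in degree `k + e`: `φ` is multiplication by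
`f`, `π` is the projection, and the kernel of `π` is the range of `φ`. -/
theorem finrank_gradedPart_add_colonBy {I : Ideal A} (hI : HomIdeal I) {f : A} {k : ℕ}
    (hf : f.IsHomogeneous k) (e : ℕ) :
    Module.finrank K (gradedPart I (k + e)) =
      Module.finrank K (gradedPart (I ⊔ Ideal.span {f}) (k + e)) +
        Module.finrank K (gradedPart (colonBy I f) e) := by
  set H := MvPolynomial.homogeneousSubmodule (Fin n) K e
  have : Module.Finite K H :=
    Module.Finite.iff_fg.mpr (MvPolynomial.homogeneousSubmodule_fg (Fin n) K e)
  have hle : I ≤ I ⊔ Ideal.span {f} := le_sup_left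
  let φ : H →ₗ[K] A ⧸ I := ((Ideal.Quotient.mkₐ K I).toLinearMap ∘ₗ LinearMap.mulLeft K f) ∘ₗ
    H.subtype
  let π : gradedPart I (k + e) →ₗ[K] A ⧸ (I ⊔ Ideal.span {f}) :=
    (Ideal.Quotient.factorₐ K hle).toLinearMap.domRestrict (gradedPart I (k + e))
  have hφ (x : H) : φ x = Ideal.Quotient.mk I (f * x) := rfl
  have hπ (x : A) (hx : Ideal.Quotient.mk I x ∈ gradedPart I (k + e)) :
    π ⟨_, hx⟩ = Ideal.Quotient.mk _ x := rfl
  have h1 := LinearMap.finrank_range_add_finrank_ker φ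
  have h2 := LinearMap.finrank_range_add_finrank_ker π
  have h3 := finrank_gradedPart_add (colonBy I f) e
  have h4 : LinearMap.ker φ = LinearMap.ker ((Ideal.Quotient.mkₐ K (colonBy I f)).toLinearMap.domRestrict
        (MvPolynomial.homogeneousSubmodule (Fin n) K e)) := by
    ext x
    have a : φ x = 0 ↔ f * (x : A) ∈ I := by rw [hφ, Ideal.Quotient.eq_zero_iff_mem]
    have b : Ideal.Quotient.mk (colonBy I f) (x : A) = 0 ↔ f * (x : A) ∈ I := by
      rw [Ideal.Quotient.eq_zero_iff_mem, mem_colonBy]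
    exact a.trans b.symm
  have h5 : LinearMap.range π = gradedPart (I ⊔ Ideal.span {f}) (k + e) := by
    rw [LinearMap.range_domRestrict, gradedPart, gradedPart, ← Submodule.map_comp]
    rfl
  have h6 : (LinearMap.ker π).map (gradedPart I (k + e)).subtype = LinearMap.range φ := by
    ext q
    constructor
    · rintro ⟨⟨q, hq⟩, hq', rfl⟩
      obtain ⟨g, hg, rfl⟩ := mem_gradedPart_iff.mp hq
      have hq2 : π ⟨_, hq⟩ = 0 := hq'
      rw [hπ, Ideal.Quotient.eq_zero_iff_mem] at hq2
      obtain ⟨a, ha, b, hb, hab⟩ := Submodule.mem_sup.mp hq2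
      obtain ⟨c, rfl⟩ := Ideal.mem_span_singleton'.mp hb
      -- The cofactor `c` need not be homogeneous, but only its degree `e` part contributes to
      -- degree `k + e`.
      refine ⟨⟨MvPolynomial.homogeneousComponent e c,
        MvPolynomial.homogeneousComponent_isHomogeneous e c⟩, ?_⟩
      rw [hφ]
      change _ = Ideal.Quotient.mk I g
      rw [eq_comm, Ideal.Quotient.mk_eq_mk_iff_sub_mem]
      have h7 := congrArg (MvPolynomial.homogeneousComponent (k + e)) hab
      rw [map_add, mul_comm c, homogeneousComponent_mul_of_isHomogeneous hf,
        MvPolynomial.homogeneousComponent_eq_self hg] at h7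
      rw [← h7, add_sub_cancel_right]
      exact hI a ha _
    · rintro ⟨x, rfl⟩
      have hx : Ideal.Quotient.mk I (f * (x : A)) ∈ gradedPart I (k + e) :=
        mem_gradedPart_iff.mpr ⟨_, hf.mul x.2, rfl⟩
      refine ⟨⟨_, hx⟩, ?_, rfl⟩
      change π _ = 0
      rw [hπ, Ideal.Quotient.eq_zero_iff_mem]
      exact Ideal.mem_sup_right (Ideal.mul_mem_right _ _ (Ideal.mem_span_singleton_self f))
  have h7 : Module.finrank K (LinearMap.ker π) = Module.finrank K (LinearMap.range φ) := by
    rw [← h6]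
    exact (LinearEquiv.finrank_eq (Submodule.equivMapOfInjective _
      (Submodule.subtype_injective _) _))
  rw [h5] at h2
  rw [h4] at h1
  have h8 : Module.finrank K (LinearMap.range φ) =
      Module.finrank K (gradedPart (colonBy I f) e) :=
    Nat.add_right_cancel (h1.trans h3.symm)
  rw [h7, h8] at h2
  exact h2.symm

theorem finrank_gradedPart_sup_of_lt {I : Ideal A} (hI : HomIdeal I) {f : A} {k e : ℕ}
    (hf : f.IsHomogeneous k) (he : e < k) :
    Module.finrank K (gradedPart I e) =
      Module.finrank K (gradedPart (I ⊔ Ideal.span {f}) e) := by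
  have h3 := finrank_gradedPart_add I e
  have h4 := finrank_gradedPart_add (I ⊔ Ideal.span {f}) e
  have h5 : LinearMap.ker ((Ideal.Quotient.mkₐ K I).toLinearMap.domRestrict
        (MvPolynomial.homogeneousSubmodule (Fin n) K e)) =
      LinearMap.ker ((Ideal.Quotient.mkₐ K (I ⊔ Ideal.span {f})).toLinearMap.domRestrict
        (MvPolynomial.homogeneousSubmodule (Fin n) K e)) := by
    ext x
    have a : Ideal.Quotient.mk I (x : A) = 0 ↔
        Ideal.Quotient.mk (I ⊔ Ideal.span {f}) (x : A) = 0 := by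
      rw [Ideal.Quotient.eq_zero_iff_mem, Ideal.Quotient.eq_zero_iff_mem]
      refine ⟨Ideal.mem_sup_left, fun h => ?_⟩
      obtain ⟨a, ha, b, hb, hab⟩ := Submodule.mem_sup.mp h
      obtain ⟨c, rfl⟩ := Ideal.mem_span_singleton'.mp hb
      have h7 := congrArg (MvPolynomial.homogeneousComponent e) hab
      rw [map_add, mul_comm c, homogeneousComponent_mul_of_lt hf he,
        MvPolynomial.homogeneousComponent_eq_self x.2, add_zero] at h7
      rw [← h7]
      exact hI a ha _
    exact a
  rw [h5] at h3
  omega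

/-- The Hilbert series along multiplication by a homogeneous element. -/
theorem hilbertSeries_eq_add {I : Ideal A} (hI : HomIdeal I) {f : A} {k : ℕ}
    (hf : f.IsHomogeneous k) :
    hilbertSeries I = hilbertSeries (I ⊔ Ideal.span {f}) +
      PowerSeries.X ^ k * hilbertSeries (colonBy I f) := by
  ext d
  rw [map_add, PowerSeries.coeff_X_pow_mul']
  simp only [hilbertSeries, PowerSeries.coeff_mk]
  split_ifs with h
  · obtain ⟨e, rfl⟩ := Nat.exists_eq_add_of_le h
    rw [Nat.add_sub_cancel_left, finrank_gradedPart_add_colonBy hI hf e]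
    push_cast
    rfl
  · rw [add_zero, finrank_gradedPart_sup_of_lt hI hf (by omega)]

theorem hilbertSeries_mono {I I' : Ideal A} (h : I ≤ I') :
    CoeffLE (hilbertSeries I') (hilbertSeries I) := fun d => by
  simp only [hilbertSeries, PowerSeries.coeff_mk]
  exact_mod_cast finrank_gradedPart_mono h d

theorem mem_of_homogeneousComponent_mem {I : Ideal A} {f : A}
    (h : ∀ e, MvPolynomial.homogeneousComponent e f ∈ I) : f ∈ I := by
  rw [← MvPolynomial.sum_homogeneousComponent f]
  exact sum_mem fun e _ => h e

theorem eq_of_hilbertSeries_eq {I I' : Ideal A} (hI' : HomIdeal I') (h : I ≤ I')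
    (hs : hilbertSeries I = hilbertSeries I') : I = I' := by
  refine le_antisymm h fun f hf => mem_of_homogeneousComponent_mem fun e => ?_
  refine mem_of_finrank_gradedPart_le h (d := e) ?_
    (MvPolynomial.homogeneousComponent_isHomogeneous e f) (hI' f hf e)
  have := congrArg (PowerSeries.coeff e) hs
  simp only [hilbertSeries, PowerSeries.coeff_mk] at this
  exact_mod_cast this.le

theorem hilbertSeries_top : hilbertSeries (⊤ : Ideal A) = 0 := by
  ext d
  simp only [hilbertSeries, PowerSeries.coeff_mk, map_zero]
  have : Subsingleton (A ⧸ (⊤ : Ideal A)) := Ideal.Quotient.subsingleton_iff.mpr rfl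
  have : Subsingleton (gradedPart (⊤ : Ideal A) d) := inferInstance
  simp [Module.finrank_zero_of_subsingleton]

/-- If `f ^ N ∈ I` then `A / I` is filtered by at most `N` shifted quotients of `A / (I + f)`. -/
theorem hilbertSeries_le_of_pow_mem {f : A} {k : ℕ} (hf : f.IsHomogeneous k) (N : ℕ) {I : Ideal A}
    (hI : HomIdeal I) (h : f ^ N ∈ I) :
    CoeffLE (hilbertSeries I) (geomSeries k N * hilbertSeries (I ⊔ Ideal.span {f})) := by
  induction N generalizing I with
  | zero =>
    rw [pow_zero, ← Ideal.eq_top_iff_one] at h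
    subst h
    rw [hilbertSeries_top, top_sup_eq, hilbertSeries_top, mul_zero]
    exact CoeffLE.refl _
  | succ N ih =>
    rw [hilbertSeries_eq_add hI hf, geomSeries_succ, add_mul, one_mul, mul_assoc]
    refine (CoeffLE.refl _).add (CoeffLE.mul_left (CoeffLE.zero_X_pow k) ?_)
    -- One power of `f` less is needed for I : f, and A/((I : f) + f) is a quotient of A/(I + f).
    refine (ih (hI.colonBy hf) (by rw [mem_colonBy, ← pow_succ']; exact h)).trans ?_
    exact CoeffLE.mul_left (zero_le_geomSeries k N)
      (hilbertSeries_mono (sup_le_sup_right (le_colonBy I f) _))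

/-- If the bound of `hilbertSeries_le_of_pow_mem` is attained, then `I : f ^ (N - 1) ≤ I + (f)`. -/
theorem mem_of_pow_mul_mem {f : A} {k : ℕ} (hf : f.IsHomogeneous k) (N : ℕ) {I : Ideal A}
    (hI : HomIdeal I) (h : f ^ (N + 1) ∈ I)
    (hs : hilbertSeries I = geomSeries k (N + 1) * hilbertSeries (I ⊔ Ideal.span {f}))
    {g : A} (hg : f ^ N * g ∈ I) : g ∈ I ⊔ Ideal.span {f} := by
  induction N generalizing I with
  | zero => exact Ideal.mem_sup_left (by simpa using hg)
  | succ N ih =>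
    have hc : HomIdeal (colonBy I f) := hI.colonBy hf
    have hp : f ^ (N + 1) ∈ colonBy I f := by rw [mem_colonBy, ← pow_succ']; exact h
    have hle : I ⊔ Ideal.span {f} ≤ colonBy I f ⊔ Ideal.span {f} :=
      sup_le_sup_right (le_colonBy I f) _
    have h1 := hilbertSeries_eq_add hI hf
    rw [hs, geomSeries_succ, add_mul, one_mul, mul_assoc] at h1
    have h2 := mul_left_cancel₀ (pow_ne_zero k PowerSeries.X_ne_zero) (add_left_cancel h1)
    -- By `h2` the series of I : f equals the upper bound obtained from I + (f). The bound through
    -- (I : f) + (f) lies in between, so the ideals I + (f) and (I : f) + (f) have equal series and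
    -- coincide; the induction then passes from I to I : f.
    have h3 := hilbertSeries_le_of_pow_mem hf (N + 1) hc hp
    have h4 := CoeffLE.mul_left (zero_le_geomSeries k (N + 1)) (hilbertSeries_mono hle)
    rw [h2] at h4
    have h5 := CoeffLE.antisymm h3 h4
    have h6 : hilbertSeries (I ⊔ Ideal.span {f}) = hilbertSeries (colonBy I f ⊔ Ideal.span {f}) :=
      mul_left_cancel₀ (geomSeries_ne_zero k N.succ_ne_zero) (h2.trans h5)
    have h7 := eq_of_hilbertSeries_eq (hc.sup (homIdeal_span_singleton hf)) hle h6
    rw [h7]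
    exact ih hc hp h5 (by rw [mem_colonBy, ← mul_assoc, ← pow_succ']; exact hg)

end Graded

/-! ### The ideals of the induction and the inclusions between them -/

section Ideals

variable (K : Type*) [Field K] {n : ℕ}

/-- The elementary symmetric polynomial of degree `j` in the `m`-th powers of the variables
indexed by `s`. -/
noncomputable def powEsymm (m : ℕ) (s : Finset (Fin n)) (j : ℕ) : MvPolynomial (Fin n) K :=
  ∑ T ∈ s.powersetCard j, ∏ k ∈ T, MvPolynomial.X k ^ m

/-- The ideal generated by the variables in `u` and the squarefree monomials of degree `r` in the
variables in `v`. -/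
noncomputable def squarefreeIdeal (u v : Finset (Fin n)) (r : ℕ) : Ideal (MvPolynomial (Fin n) K) :=
  Ideal.span ({f | ∃ k ∈ u, f = MvPolynomial.X k} ∪
    {f | ∃ T ⊆ v, T.card = r ∧ f = ∏ k ∈ T, MvPolynomial.X k})

/-- The sum of `squarefreeIdeal K u v r` and the ideal generated by the elementary symmetric
polynomials of positive degree in the `m`-th powers of the variables in `w`. -/
noncomputable def symmIdeal (m : ℕ) (u v w : Finset (Fin n)) (r : ℕ) :
    Ideal (MvPolynomial (Fin n) K) :=
  squarefreeIdeal K u v r ⊔ Ideal.span {f | ∃ j, 1 ≤ j ∧ f = powEsymm K m w j}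

variable {K} {m r : ℕ} {s u v w : Finset (Fin n)} {a : Fin n}

theorem powEsymm_zero : powEsymm K m s 0 = 1 := by simp [powEsymm]

theorem powEsymm_card : powEsymm K m s s.card = (∏ k ∈ s, MvPolynomial.X k) ^ m := by
  simp [powEsymm, Finset.prod_pow]

theorem powEsymm_isHomogeneous (m : ℕ) (s : Finset (Fin n)) (j : ℕ) :
    (powEsymm K m s j).IsHomogeneous (m * j) := by
  refine MvPolynomial.IsHomogeneous.sum _ _ _ fun T hT => ?_
  have h : ∑ _k ∈ T, m = m * j := by
    rw [Finset.sum_const, (Finset.mem_powersetCard.mp hT).2, smul_eq_mul, mul_comm]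
  rw [← h]
  exact MvPolynomial.IsHomogeneous.prod T _ _ fun k _ => MvPolynomial.isHomogeneous_X_pow k m

theorem powEsymm_succ_eq (ha : a ∈ s) (j : ℕ) :
    powEsymm K m s (j + 1) =
      powEsymm K m (s.erase a) (j + 1) + MvPolynomial.X a ^ m * powEsymm K m (s.erase a) j := by
  conv_lhs => rw [powEsymm, ← Finset.insert_erase ha,
    Finset.powersetCard_succ_insert (Finset.notMem_erase a s)]
  have hT : ∀ T ∈ (s.erase a).powersetCard j, a ∉ T := fun T hT h =>
    Finset.notMem_erase a s ((Finset.mem_powersetCard.mp hT).1 h)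
  rw [Finset.sum_union, Finset.sum_image, powEsymm, powEsymm, Finset.mul_sum]
  · congr 1
    exact Finset.sum_congr rfl fun T h => by rw [Finset.prod_insert (hT T h)]
  · intro T h T' h' e
    rw [← Finset.erase_insert (hT T h), ← Finset.erase_insert (hT T' h'), e]
  · rw [Finset.disjoint_left]
    intro T h h'
    obtain ⟨T', -, rfl⟩ := Finset.mem_image.mp h'
    exact Finset.notMem_erase a s ((Finset.mem_powersetCard.mp h).1 (Finset.mem_insert_self a T'))

theorem homIdeal_squarefreeIdeal : HomIdeal (squarefreeIdeal K u v r) := by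
  refine homIdeal_span ?_
  rintro f (⟨k, -, rfl⟩ | ⟨T, -, -, rfl⟩)
  · exact ⟨1, MvPolynomial.isHomogeneous_X K k⟩
  · exact ⟨∑ k ∈ T, 1,
      MvPolynomial.IsHomogeneous.prod T _ _ fun k _ => MvPolynomial.isHomogeneous_X K k⟩

theorem homIdeal_symmIdeal : HomIdeal (symmIdeal K m u v w r) :=
  homIdeal_squarefreeIdeal.sup (homIdeal_span fun _ ⟨j, _, h⟩ =>
    ⟨m * j, h ▸ powEsymm_isHomogeneous m w j⟩)

theorem squarefreeIdeal_le_iff {I : Ideal (MvPolynomial (Fin n) K)} :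
    squarefreeIdeal K u v r ≤ I ↔ (∀ k ∈ u, MvPolynomial.X k ∈ I) ∧
      ∀ T ⊆ v, T.card = r → ∏ k ∈ T, MvPolynomial.X k ∈ I := by
  rw [squarefreeIdeal, Ideal.span_le]
  constructor
  · exact fun h => ⟨fun k hk => h (Or.inl ⟨k, hk, rfl⟩), fun T hT hr => h (Or.inr ⟨T, hT, hr, rfl⟩)⟩
  · rintro ⟨h, h'⟩ f (⟨k, hk, rfl⟩ | ⟨T, hT, hr, rfl⟩)
    exacts [h k hk, h' T hT hr]

theorem symmIdeal_le_iff {I : Ideal (MvPolynomial (Fin n) K)} :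
    symmIdeal K m u v w r ≤ I ↔ (∀ k ∈ u, MvPolynomial.X k ∈ I) ∧
      (∀ T ⊆ v, T.card = r → ∏ k ∈ T, MvPolynomial.X k ∈ I) ∧
      ∀ j, 1 ≤ j → powEsymm K m w j ∈ I := by
  rw [symmIdeal, sup_le_iff, squarefreeIdeal_le_iff, Ideal.span_le, and_assoc]
  refine and_congr_right fun _ => and_congr_right fun _ => ?_
  exact ⟨fun h j hj => h ⟨j, hj, rfl⟩, fun h f ⟨j, hj, e⟩ => e ▸ h j hj⟩

theorem X_mem_symmIdeal {k : Fin n} (hk : k ∈ u) : MvPolynomial.X k ∈ symmIdeal K m u v w r :=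
  (symmIdeal_le_iff.mp le_rfl).1 k hk

theorem prod_X_mem_symmIdeal {T : Finset (Fin n)} (hT : T ⊆ v) (hr : T.card = r) :
    ∏ k ∈ T, MvPolynomial.X k ∈ symmIdeal K m u v w r :=
  (symmIdeal_le_iff.mp le_rfl).2.1 T hT hr

theorem powEsymm_mem_symmIdeal {j : ℕ} (hj : 1 ≤ j) :
    powEsymm K m w j ∈ symmIdeal K m u v w r :=
  (symmIdeal_le_iff.mp le_rfl).2.2 j hj

theorem powEsymm_mem_squarefreeIdeal (hm : 1 ≤ m) {j : ℕ} (hj : r ≤ j) :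
    powEsymm K m s j ∈ squarefreeIdeal K u s r := by
  refine sum_mem fun T hT => ?_
  rw [Finset.mem_powersetCard] at hT
  obtain ⟨T', hT', hr⟩ := Finset.exists_subset_card_eq (hj.trans hT.2.ge)
  refine Ideal.mem_of_dvd _ ?_ ((squarefreeIdeal_le_iff.mp le_rfl).2 T' (hT'.trans hT.1) hr)
  calc ∏ k ∈ T', (MvPolynomial.X k : MvPolynomial (Fin n) K) ∣ ∏ k ∈ T, MvPolynomial.X k :=
        Finset.prod_dvd_prod_of_subset _ _ _ hT'
    _ ∣ ∏ k ∈ T, MvPolynomial.X k ^ m :=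
        Finset.prod_dvd_prod_of_dvd _ _ fun k _ => dvd_pow_self _ (by omega)

/-- Modulo x_a the elementary symmetric polynomials of `s` reduce to those of `s.erase a`. -/
theorem symmIdeal_erase_le (hm : 1 ≤ m) (ha : a ∈ s) (hv : s.erase a ⊆ v) :
    symmIdeal K m (s.erase a)ᶜ (s.erase a) (s.erase a) r ≤
      symmIdeal K m sᶜ v s r ⊔ Ideal.span {MvPolynomial.X a} := by
  have hX : (MvPolynomial.X a : MvPolynomial (Fin n) K) ∈
      symmIdeal K m sᶜ v s r ⊔ Ideal.span {MvPolynomial.X a} :=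
    Ideal.mem_sup_right (Ideal.mem_span_singleton_self _)
  refine symmIdeal_le_iff.mpr ⟨fun k hk => ?_, fun T hT hr => ?_, fun j hj => ?_⟩
  · by_cases h : k = a
    · exact h ▸ hX
    · exact Ideal.mem_sup_left (X_mem_symmIdeal (by simpa [h] using hk))
  · exact Ideal.mem_sup_left (prod_X_mem_symmIdeal (hT.trans hv) hr)
  · obtain ⟨j, rfl⟩ := Nat.exists_eq_add_of_le' hj
    rw [eq_sub_iff_add_eq.mpr (powEsymm_succ_eq ha j).symm]
    exact sub_mem (Ideal.mem_sup_left (powEsymm_mem_symmIdeal hj))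
      (Ideal.mul_mem_right _ _ (Ideal.pow_mem_of_mem _ hX _ hm))

theorem symmIdeal_le_colonBy (ha : a ∈ s) :
    symmIdeal K m sᶜ (s.erase a) s r ≤
      colonBy (symmIdeal K m sᶜ s s (r + 1)) (MvPolynomial.X a) := by
  refine symmIdeal_le_iff.mpr ⟨fun k hk => ?_, fun T hT hr => ?_, fun j hj => ?_⟩
  · exact le_colonBy _ _ (X_mem_symmIdeal hk)
  · have h : a ∉ T := fun h => Finset.notMem_erase a s (hT h)
    rw [mem_colonBy, ← Finset.prod_insert h]
    exact prod_X_mem_symmIdeal (Finset.insert_subset ha (hT.trans (Finset.erase_subset a s)))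
      (by rw [Finset.card_insert_of_notMem h, hr])
  · exact le_colonBy _ _ (powEsymm_mem_symmIdeal hj)

/-- Modulo the e_j of `s`, the recurrence for removing `a` gives e_j(s \ a) ≡ (-x_a^m)^j. For j = r
the left side consists of multiples of squarefree monomials of degree r in `s.erase a`. -/
theorem X_pow_mem_symmIdeal (hm : 1 ≤ m) (ha : a ∈ s) :
    MvPolynomial.X a ^ (r * m) ∈ symmIdeal K m u (s.erase a) s r := by
  have key : ∀ j, powEsymm K m (s.erase a) j - (-MvPolynomial.X a ^ m) ^ j ∈
      symmIdeal K m u (s.erase a) s r := fun j => by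
    induction j with
    | zero => simp [powEsymm_zero]
    | succ j ih =>
      have h := powEsymm_mem_symmIdeal (K := K) (m := m) (u := u) (v := s.erase a) (w := s) (r := r)
        j.succ_pos
      rw [Nat.succ_eq_add_one, powEsymm_succ_eq ha] at h
      have e : powEsymm K m (s.erase a) (j + 1) - (-MvPolynomial.X a ^ m) ^ (j + 1) =
        powEsymm K m (s.erase a) (j + 1) + MvPolynomial.X a ^ m * powEsymm K m (s.erase a) j -
          MvPolynomial.X a ^ m *
            (powEsymm K m (s.erase a) j - (-MvPolynomial.X a ^ m) ^ j) := by ring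
      rw [e]
      exact sub_mem h (Ideal.mul_mem_left _ _ ih)
  have h1 : powEsymm K m (s.erase a) r ∈ symmIdeal K m u (s.erase a) s r :=
    Ideal.mem_sup_left (powEsymm_mem_squarefreeIdeal hm le_rfl)
  have h2 := sub_mem h1 (key r)
  rw [sub_sub_cancel, neg_pow, ← pow_mul, mul_comm m] at h2
  rcases neg_one_pow_eq_or (MvPolynomial (Fin n) K) r with h | h
  · simpa [h] using h2
  · simpa [h] using h2

/-- On both sides the required degree exceeds the number of available variables, so no squarefree
generator is left. -/
theorem symmIdeal_erase_eq_of_card (hs : s.card = r + 1) (ha : a ∈ s) :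
    symmIdeal K m sᶜ (s.erase a) s (r + 1) = symmIdeal K m sᶜ s s (r + 2) := by
  -- The right side is an arbitrary reference ideal without squarefree generators: the empty set has
  -- no subset of positive size.
  have h : ∀ v ⊆ s, ∀ r', v.card < r' →
      symmIdeal K m sᶜ v s r' = symmIdeal K m sᶜ ∅ s (r + 3) := fun v _ r' hr' => by
    refine le_antisymm ?_ ?_ <;>
    refine symmIdeal_le_iff.mpr ⟨fun k hk => X_mem_symmIdeal hk, fun T hT hr => ?_,
      fun j hj => powEsymm_mem_symmIdeal hj⟩
    · have := Finset.card_le_card hT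
      omega
    · have := Finset.card_le_card hT
      simp only [Finset.card_empty] at this
      omega
  rw [h _ (Finset.erase_subset a s) _ (by rw [Finset.card_erase_of_mem ha]; omega),
    h s subset_rfl _ (by omega)]

theorem X_mem_symmIdeal_one (k : Fin n) : MvPolynomial.X k ∈ symmIdeal K m sᶜ s w 1 := by
  by_cases hk : k ∈ s
  · simpa using prod_X_mem_symmIdeal (K := K) (m := m) (u := sᶜ) (w := w) (r := 1)
      (Finset.singleton_subset_iff.mpr hk) (Finset.card_singleton k)
  · exact X_mem_symmIdeal (by simpa using hk)

/-! ### Colon ideals and sums for the squarefree monomial ideals -/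

theorem mem_squarefreeIdeal_iff {f : MvPolynomial (Fin n) K} :
    f ∈ squarefreeIdeal K u v r ↔ ∀ e ∈ f.support, (∃ k ∈ u, e k ≠ 0) ∨
      ∃ T ⊆ v, T.card = r ∧ ∀ k ∈ T, e k ≠ 0 := by
  have h : squarefreeIdeal K u v r = Ideal.span ((fun e => MvPolynomial.monomial e (1 : K)) ''
      ({e | ∃ k ∈ u, e = Finsupp.single k 1} ∪
        {e | ∃ T ⊆ v, T.card = r ∧ e = ∑ k ∈ T, Finsupp.single k 1})) := by
    have hT (T : Finset (Fin n)) : MvPolynomial.monomial (∑ k ∈ T, Finsupp.single k 1) (1 : K) =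
        ∏ k ∈ T, MvPolynomial.X k := by
      rw [MvPolynomial.monomial_sum_one]
      rfl
    rw [squarefreeIdeal, Set.image_union]
    congr 2
    · ext f
      constructor
      · rintro ⟨k, hk, rfl⟩
        exact ⟨_, ⟨k, hk, rfl⟩, rfl⟩
      · rintro ⟨_, ⟨k, hk, rfl⟩, rfl⟩
        exact ⟨k, hk, rfl⟩
    · ext f
      constructor
      · rintro ⟨T, h1, h2, rfl⟩
        exact ⟨_, ⟨T, h1, h2, rfl⟩, hT T⟩
      · rintro ⟨_, ⟨T, h1, h2, rfl⟩, rfl⟩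
        exact ⟨T, h1, h2, hT T⟩
  rw [h, MvPolynomial.mem_ideal_span_monomial_image]
  refine forall₂_congr fun e _ => ?_
  have hle (T : Finset (Fin n)) : ∑ k ∈ T, Finsupp.single k 1 ≤ e ↔ ∀ k ∈ T, e k ≠ 0 := by
    have (k : Fin n) : (∑ i ∈ T, Finsupp.single i 1 : Fin n →₀ ℕ) k = if k ∈ T then 1 else 0 := by
      simp [Finsupp.finsetSum_apply, Finsupp.single_apply]
    refine ⟨fun h k hk => ?_, fun h k => ?_⟩
    · have h1 := h k
      rw [this, if_pos hk] at h1
      omega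
    · rw [this]
      split_ifs with hk
      · exact Nat.one_le_iff_ne_zero.mpr (h k hk)
      · exact Nat.zero_le _
  constructor
  · rintro ⟨_, ⟨k, hk, rfl⟩ | ⟨T, h1, h2, rfl⟩, h⟩
    · exact Or.inl ⟨k, hk, by simpa using (hle {k}).mp (by simpa using h)⟩
    · exact Or.inr ⟨T, h1, h2, (hle T).mp h⟩
  · rintro (⟨k, hk, h⟩ | ⟨T, h1, h2, h⟩)
    · exact ⟨_, Or.inl ⟨k, hk, rfl⟩, by simpa using (hle {k}).mpr (by simpa using h)⟩
    · exact ⟨_, Or.inr ⟨T, h1, h2, rfl⟩, (hle T).mpr h⟩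

theorem support_X_mul_mem {f : MvPolynomial (Fin n) K} {e : Fin n →₀ ℕ} (he : e ∈ f.support)
    (a : Fin n) : e + Finsupp.single a 1 ∈ (MvPolynomial.X a * f).support := by
  rw [MvPolynomial.mem_support_iff] at he ⊢
  rwa [mul_comm, MvPolynomial.coeff_mul_X]

/-- Multiplying by x_a changes only the exponent at `a`, so at most one variable of a squarefree
divisor is lost. Lower bounds on Hilbert series need upper bounds on ideals, hence this direction.
-/
theorem colonBy_squarefreeIdeal_le (ha : a ∈ s) :
    colonBy (squarefreeIdeal K sᶜ s (r + 1)) (MvPolynomial.X a) ≤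
      squarefreeIdeal K sᶜ (s.erase a) r := by
  intro f hf
  rw [mem_colonBy, mem_squarefreeIdeal_iff] at hf
  rw [mem_squarefreeIdeal_iff]
  intro e he
  have hne : ∀ k, k ≠ a → (e + Finsupp.single a 1 : Fin n →₀ ℕ) k = e k := fun k hk => by
    simp [hk]
  rcases hf _ (support_X_mul_mem he a) with ⟨k, hk, h⟩ | ⟨T, h1, h2, h⟩
  · have : k ≠ a := by rintro rfl; simp [ha] at hk
    exact Or.inl ⟨k, hk, hne k this ▸ h⟩
  · obtain ⟨T', hT', hr⟩ := Finset.exists_subset_card_eq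
      (show r ≤ (T.erase a).card from by have := Finset.pred_card_le_card_erase (s := T) (a := a); omega)
    refine Or.inr ⟨T', hT'.trans (Finset.erase_subset_erase a h1), hr, fun k hk => ?_⟩
    have := Finset.mem_erase.mp (hT' hk)
    exact hne k this.1 ▸ h k this.2

/-- No generator involves x_a, so x_a is a nonzerodivisor modulo the ideal. -/
theorem colonBy_squarefreeIdeal_erase_le (hu : a ∉ u) (hv : a ∉ v) :
    colonBy (squarefreeIdeal K u v r) (MvPolynomial.X a) ≤ squarefreeIdeal K u v r := by
  intro f hf
  rw [mem_colonBy, mem_squarefreeIdeal_iff] at hf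
  rw [mem_squarefreeIdeal_iff]
  intro e he
  have hne : ∀ k, k ≠ a → (e + Finsupp.single a 1 : Fin n →₀ ℕ) k = e k := fun k hk => by
    simp [hk]
  rcases hf _ (support_X_mul_mem he a) with ⟨k, hk, h⟩ | ⟨T, h1, h2, h⟩
  · exact Or.inl ⟨k, hk, hne k (fun h' => hu (h' ▸ hk)) ▸ h⟩
  · exact Or.inr ⟨T, h1, h2, fun k hk => hne k (fun h' => hv (h1 (h' ▸ hk))) ▸ h k hk⟩

theorem squarefreeIdeal_sup_le (hvs : v ⊆ s) :
    squarefreeIdeal K sᶜ v r ⊔ Ideal.span {MvPolynomial.X a} ≤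
      squarefreeIdeal K (s.erase a)ᶜ (s.erase a) r := by
  have hX : ∀ k ∉ s.erase a, MvPolynomial.X k ∈ squarefreeIdeal K (s.erase a)ᶜ (s.erase a) r :=
    fun k hk => (squarefreeIdeal_le_iff.mp le_rfl).1 k (Finset.mem_compl.mpr hk)
  refine sup_le (squarefreeIdeal_le_iff.mpr ⟨fun k hk => hX k ?_, fun T hT h => ?_⟩) ?_
  · simp only [Finset.mem_compl] at hk
    exact fun h => hk (Finset.mem_of_mem_erase h)
  · by_cases haT : a ∈ T
    · exact Ideal.mem_of_dvd _ (Finset.dvd_prod_of_mem _ haT) (hX a (Finset.notMem_erase a s))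
    · exact (squarefreeIdeal_le_iff.mp le_rfl).2 T
        (Finset.subset_erase.mpr ⟨hT.trans hvs, haT⟩) h
  · rw [Ideal.span_singleton_le_iff_mem]
    exact hX a (Finset.notMem_erase a s)

theorem squarefreeIdeal_le_of_card (hs : s.card = r + 1) :
    squarefreeIdeal K sᶜ s (r + 2) ≤ squarefreeIdeal K sᶜ (s.erase a) (r + 1) := by
  refine squarefreeIdeal_le_iff.mpr ⟨(squarefreeIdeal_le_iff.mp le_rfl).1, fun T hT h => ?_⟩
  have := Finset.card_le_card hT
  omega

end Ideals

/-! ### Upper bound, lower bound and the exact Hilbert series -/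

/-- The Hilbert series of `symmIdeal K m sᶜ s s (d + 1)` for `s` of cardinality `c + d`. -/
noncomputable def symmSeries (m : ℕ) : ℕ → ℕ → ℚ⟦X⟧
  | _, 0 => 1
  | 0, d + 1 => geomSeries 1 ((d + 1) * m) * symmSeries m 0 d
  | c + 1, d + 1 => symmSeries m c (d + 1) +
      PowerSeries.X ^ 1 * (geomSeries 1 ((d + 1) * m) * symmSeries m (c + 1) d)

theorem symmSeries_zero_right (m c : ℕ) : symmSeries m c 0 = 1 := by
  rw [symmSeries]

theorem symmSeries_zero_succ (m d : ℕ) :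
    symmSeries m 0 (d + 1) = geomSeries 1 ((d + 1) * m) * symmSeries m 0 d := by
  rw [symmSeries]

theorem symmSeries_succ_succ (m c d : ℕ) :
    symmSeries m (c + 1) (d + 1) = symmSeries m c (d + 1) +
      PowerSeries.X ^ 1 * (geomSeries 1 ((d + 1) * m) * symmSeries m (c + 1) d) := by
  rw [symmSeries]

theorem geomSeries_mul_geomInv {N : ℕ} (hN : N ≠ 0) :
    geomSeries 1 N * geomInv N = geomInv 1 := by
  have h := geomSeries_mul_one_sub 1 N
  rw [one_mul] at h
  linear_combination geomInv 1 * geomInv N * h + geomInv 1 * one_sub_mul_geomInv hN -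
    geomSeries 1 N * geomInv N * one_sub_mul_geomInv one_ne_zero

section

variable {K : Type*} [Field K] {n : ℕ} {m : ℕ} {s : Finset (Fin n)} {a : Fin n}

theorem mem_of_isHomogeneous_of_X_mem {I : Ideal (MvPolynomial (Fin n) K)}
    (hI : ∀ k, MvPolynomial.X k ∈ I) {f : MvPolynomial (Fin n) K} {e : ℕ} (hf : f.IsHomogeneous e)
    (he : e ≠ 0) : f ∈ I := by
  have h : f ∈ Ideal.span (MvPolynomial.X '' (Set.univ : Set (Fin n))) := by
    rw [MvPolynomial.mem_ideal_span_X_image]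
    intro x hx
    by_contra! h
    have hx0 : x = 0 := Finsupp.ext fun k => by simpa using h k (Set.mem_univ k)
    have := hf.coeff_eq_zero (d := x) (by simpa [hx0] using he.symm)
    exact (MvPolynomial.mem_support_iff.mp hx) this
  refine Ideal.span_le.mpr ?_ h
  rintro _ ⟨k, -, rfl⟩
  exact hI k

theorem hilbertSeries_le_one {I : Ideal (MvPolynomial (Fin n) K)}
    (hI : ∀ k, MvPolynomial.X k ∈ I) : CoeffLE (hilbertSeries I) 1 := by
  intro d
  simp only [hilbertSeries, PowerSeries.coeff_mk, PowerSeries.coeff_one]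
  split_ifs with hd
  · subst hd
    have h := finrank_gradedPart_add I 0
    have h1 : Module.finrank K (MvPolynomial.homogeneousSubmodule (Fin n) K 0) = 1 := by
      rw [MvPolynomial.homogeneousSubmodule_zero, Submodule.one_eq_span]
      exact finrank_span_singleton one_ne_zero
    have h2 : Module.finrank K (gradedPart I 0) ≤ 1 := by omega
    exact_mod_cast h2
  · have h : gradedPart I d = ⊥ := by
      rw [eq_bot_iff]
      intro q hq
      obtain ⟨f, hf, rfl⟩ := mem_gradedPart_iff.mp hq
      exact Ideal.Quotient.eq_zero_iff_mem.mpr (mem_of_isHomogeneous_of_X_mem hI hf hd)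
    simp [h]

theorem one_le_hilbertSeries {I : Ideal (MvPolynomial (Fin n) K)} (hI : 1 ∉ I) :
    CoeffLE 1 (hilbertSeries I) := by
  intro d
  simp only [hilbertSeries, PowerSeries.coeff_mk, PowerSeries.coeff_one]
  split_ifs with hd
  · subst hd
    have h : gradedPart I 0 ≠ ⊥ := fun h => by
      have h1 : Ideal.Quotient.mk I 1 ∈ gradedPart I 0 :=
        mem_gradedPart_iff.mpr ⟨1, MvPolynomial.isHomogeneous_one _ _, rfl⟩
      rw [h, Submodule.mem_bot, Ideal.Quotient.eq_zero_iff_mem] at h1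
      exact hI h1
    have h2 : 1 ≤ Module.finrank K (gradedPart I 0) := Submodule.one_le_finrank_iff.mpr h
    exact_mod_cast h2
  · positivity

theorem hilbertSeries_symmIdeal_erase_le (hm : 1 ≤ m) (ha : a ∈ s) {d : ℕ} {g : ℚ⟦X⟧}
    (h : CoeffLE (hilbertSeries
      (symmIdeal K m (s.erase a)ᶜ (s.erase a) (s.erase a) (d + 1))) g) :
    CoeffLE (hilbertSeries (symmIdeal K m sᶜ (s.erase a) s (d + 1)))
      (geomSeries 1 ((d + 1) * m) * g) :=
  (hilbertSeries_le_of_pow_mem (MvPolynomial.isHomogeneous_X K a) _ homIdeal_symmIdeal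
    (X_pow_mem_symmIdeal hm ha)).trans (CoeffLE.mul_left (zero_le_geomSeries _ _)
      ((hilbertSeries_mono (symmIdeal_erase_le hm ha subset_rfl)).trans h))

/-- Induction along the recursion of `symmSeries`. For d = 0 all variables lie in the ideal; for c =
0 there are no squarefree generators and the nilpotency of x_a suffices; otherwise the exact
sequence for x_a is used. -/
theorem hilbertSeries_symmIdeal_le (hm : 1 ≤ m) (d c : ℕ) {s : Finset (Fin n)}
    (hs : s.card = c + d) :
    CoeffLE (hilbertSeries (symmIdeal K m sᶜ s s (d + 1))) (symmSeries m c d) := by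
  induction d generalizing c s with
  | zero =>
    rw [symmSeries_zero_right]
    exact hilbertSeries_le_one X_mem_symmIdeal_one
  | succ d ihd =>
    induction c generalizing s with
    | zero =>
      obtain ⟨a, ha⟩ := Finset.card_pos.mp (show 0 < s.card by omega)
      rw [← symmIdeal_erase_eq_of_card (by omega) ha, symmSeries_zero_succ]
      exact hilbertSeries_symmIdeal_erase_le hm ha
        (ihd 0 (by rw [Finset.card_erase_of_mem ha]; omega))
    | succ c ihc =>
      obtain ⟨a, ha⟩ := Finset.card_pos.mp (show 0 < s.card by omega)
      rw [hilbertSeries_eq_add homIdeal_symmIdeal (MvPolynomial.isHomogeneous_X K a),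
        symmSeries_succ_succ]
      refine CoeffLE.add ?_ (CoeffLE.mul_left (CoeffLE.zero_X_pow 1) ?_)
      · exact (hilbertSeries_mono (symmIdeal_erase_le hm ha (Finset.erase_subset a s))).trans
          (ihc (by rw [Finset.card_erase_of_mem ha]; omega))
      · exact (hilbertSeries_mono (symmIdeal_le_colonBy ha)).trans
          (hilbertSeries_symmIdeal_erase_le hm ha
            (ihd (c + 1) (by rw [Finset.card_erase_of_mem ha]; omega)))

/-- The variable x_a is free modulo the ideal on the left-out vertex, so it contributes a factor
1/(1 - t). -/
theorem hilbertSeries_squarefreeIdeal_erase_ge (ha : a ∈ s) {r : ℕ} {g : ℚ⟦X⟧}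
    (h : CoeffLE g (hilbertSeries (squarefreeIdeal K (s.erase a)ᶜ (s.erase a) r))) :
    CoeffLE (geomInv 1 * g) (hilbertSeries (squarefreeIdeal K sᶜ (s.erase a) r)) := by
  refine CoeffLE.geomInv_mul' one_ne_zero ?_
  conv => enter [2]; rw [hilbertSeries_eq_add homIdeal_squarefreeIdeal
    (MvPolynomial.isHomogeneous_X K a)]
  refine (h.trans (hilbertSeries_mono (squarefreeIdeal_sup_le (Finset.erase_subset a s)))).add
    (CoeffLE.mul_left (CoeffLE.zero_X_pow 1) (hilbertSeries_mono
      (colonBy_squarefreeIdeal_erase_le (by simpa using ha) (Finset.notMem_erase a s))))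

theorem le_hilbertSeries_squarefreeIdeal (hm : 1 ≤ m) (d c : ℕ) {s : Finset (Fin n)}
    (hs : s.card = c + d) :
    CoeffLE (symmSeries m c d * ∏ j ∈ Finset.range d, geomInv ((j + 1) * m))
      (hilbertSeries (squarefreeIdeal K sᶜ s (d + 1))) := by
  -- The truncated geometric factor of `symmSeries` times the new factor 1/(1 - t^((d+1)m)) is 1/(1
  -- - t), the contribution of a free variable.
  have hmul (d : ℕ) (g h : ℚ⟦X⟧) : geomSeries 1 ((d + 1) * m) * g *
      (h * geomInv ((d + 1) * m)) = geomInv 1 * (g * h) := by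
    rw [← geomSeries_mul_geomInv (N := (d + 1) * m) (by positivity)]
    ring
  induction d generalizing c s with
  | zero =>
    rw [symmSeries_zero_right, Finset.prod_range_zero, mul_one]
    refine one_le_hilbertSeries fun h => ?_
    rw [mem_squarefreeIdeal_iff] at h
    rcases h 0 (by simp) with ⟨k, -, hk⟩ | ⟨T, -, hT, h0⟩
    · simp at hk
    · obtain ⟨k, hk⟩ := Finset.card_pos.mp (show 0 < T.card by omega)
      exact h0 k hk (by simp)
  | succ d ihd =>
    induction c generalizing s with
    | zero =>
      obtain ⟨a, ha⟩ := Finset.card_pos.mp (show 0 < s.card by omega)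
      refine CoeffLE.trans ?_ (hilbertSeries_mono (squarefreeIdeal_le_of_card (a := a) (by omega)))
      rw [symmSeries_zero_succ, Finset.prod_range_succ, hmul]
      exact hilbertSeries_squarefreeIdeal_erase_ge ha
        (ihd 0 (by rw [Finset.card_erase_of_mem ha]; omega))
    | succ c ihc =>
      obtain ⟨a, ha⟩ := Finset.card_pos.mp (show 0 < s.card by omega)
      rw [hilbertSeries_eq_add homIdeal_squarefreeIdeal (MvPolynomial.isHomogeneous_X K a),
        symmSeries_succ_succ, add_mul]
      refine CoeffLE.add ?_ ?_
      · exact (ihc (by rw [Finset.card_erase_of_mem ha]; omega)).trans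
          (hilbertSeries_mono (squarefreeIdeal_sup_le subset_rfl))
      · rw [mul_assoc, Finset.prod_range_succ, hmul]
        refine CoeffLE.mul_left (CoeffLE.zero_X_pow 1) (CoeffLE.trans ?_
          (hilbertSeries_mono (colonBy_squarefreeIdeal_le ha)))
        exact hilbertSeries_squarefreeIdeal_erase_ge ha
            (ihd (c + 1) (by rw [Finset.card_erase_of_mem ha]; omega))

/-- Adding homogeneous elements of positive degree to an ideal: the Hilbert series is at least the
one for a regular sequence. -/
theorem hilbertSeries_le_prod_mul {I : Ideal (MvPolynomial (Fin n) K)} (hI : HomIdeal I)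
    (θ : ℕ → MvPolynomial (Fin n) K) (deg : ℕ → ℕ) (hθ : ∀ j, (θ j).IsHomogeneous (deg j))
    (hdeg : ∀ j, deg j ≠ 0) (k : ℕ) :
    CoeffLE (hilbertSeries I) ((∏ j ∈ Finset.range k, geomInv (deg j)) *
      hilbertSeries (I ⊔ Ideal.span {f | ∃ j < k, f = θ j})) := by
  have hhom (k : ℕ) : HomIdeal (I ⊔ Ideal.span {f | ∃ j < k, f = θ j}) :=
    hI.sup (homIdeal_span fun f ⟨j, _, e⟩ => ⟨deg j, e ▸ hθ j⟩)
  have hpos (k : ℕ) : CoeffLE 0 (∏ j ∈ Finset.range k, geomInv (deg j)) :=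
    CoeffLE.zero_prod _ _ fun j _ => zero_le_geomInv (hdeg j)
  induction k with
  | zero => simpa using CoeffLE.refl _
  | succ k ih =>
    refine ih.trans ?_
    rw [Finset.prod_range_succ, mul_assoc]
    -- A colon ideal contains the original ideal, so H(I) ≤ H(I + θ) + t^deg H(I); equality would
    -- hold for a nonzerodivisor.
    refine CoeffLE.mul_left (hpos k) (CoeffLE.geomInv_mul (hdeg k) ?_)
    conv => enter [1]; rw [hilbertSeries_eq_add (hhom k) (hθ k)]
    refine (hilbertSeries_mono (sup_le (le_sup_left.trans le_sup_left) ?_)).add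
      (CoeffLE.mul_left (CoeffLE.zero_X_pow _) (hilbertSeries_mono (le_colonBy _ _)))
    rw [Ideal.span_le]
    rintro f ⟨j, hj, rfl⟩
    rcases Nat.lt_succ_iff_lt_or_eq.mp hj with h | rfl
    · exact Ideal.mem_sup_left (Ideal.mem_sup_right (Ideal.subset_span ⟨j, h, rfl⟩))
    · exact Ideal.mem_sup_right (Ideal.mem_span_singleton_self _)

/-- The upper bound becomes an equality after multiplication by the product of the 1/(1 - t^(jm)),
where the lower bound for the squarefree ideal applies; that product is nonnegative with constant
term one. -/
theorem hilbertSeries_symmIdeal (hm : 1 ≤ m) {d c : ℕ} (hs : s.card = c + d) :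
    hilbertSeries (symmIdeal K m sᶜ s s (d + 1)) = symmSeries m c d := by
  have hdeg (j : ℕ) : (j + 1) * m ≠ 0 := by positivity
  have hpos : CoeffLE 0 (∏ j ∈ Finset.range d, geomInv ((j + 1) * m)) :=
    CoeffLE.zero_prod _ _ fun j _ => zero_le_geomInv (hdeg j)
  refine CoeffLE.eq_of_mul_right (k := ∏ j ∈ Finset.range d, geomInv ((j + 1) * m))
    (hilbertSeries_symmIdeal_le hm d c hs) hpos ?_ ?_
  · rw [PowerSeries.coeff_zero_eq_constantCoeff_apply, map_prod]
    refine Finset.prod_eq_one fun j _ => ?_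
    rw [← PowerSeries.coeff_zero_eq_constantCoeff_apply, coeff_zero_geomInv (hdeg j)]
  · refine (le_hilbertSeries_squarefreeIdeal (K := K) hm d c hs).trans ?_
    rw [mul_comm]
    refine (hilbertSeries_le_prod_mul homIdeal_squarefreeIdeal
      (fun j => powEsymm K m s (j + 1)) (fun j => (j + 1) * m)
      (fun j => mul_comm m _ ▸ powEsymm_isHomogeneous m s (j + 1)) hdeg d).trans ?_
    refine CoeffLE.mul_left hpos (hilbertSeries_mono (symmIdeal_le_iff.mpr ⟨fun k hk =>
      Ideal.mem_sup_left ((squarefreeIdeal_le_iff.mp le_rfl).1 k hk), fun T hT hr =>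
      Ideal.mem_sup_left ((squarefreeIdeal_le_iff.mp le_rfl).2 T hT hr), fun j hj => ?_⟩))
    -- Only e_1, ..., e_d are counted as parameters; for j > d, e_j already lies in the squarefree
    -- ideal.
    rcases Nat.lt_or_ge d j with h | h
    · exact Ideal.mem_sup_left (powEsymm_mem_squarefreeIdeal hm h)
    · exact Ideal.mem_sup_right (Ideal.subset_span
        ⟨j - 1, by omega, by rw [Nat.sub_add_cancel hj]⟩)

theorem symmIdeal_erase_sup_eq (hm : 1 ≤ m) (ha : a ∈ s) {d c : ℕ} (hs : s.card = c + d + 1)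
    (h : hilbertSeries (symmIdeal K m sᶜ (s.erase a) s (d + 1)) =
      geomSeries 1 ((d + 1) * m) * symmSeries m c d) :
    symmIdeal K m sᶜ (s.erase a) s (d + 1) ⊔ Ideal.span {MvPolynomial.X a} =
      symmIdeal K m (s.erase a)ᶜ (s.erase a) (s.erase a) (d + 1) := by
  have hs' : (s.erase a).card = c + d := by rw [Finset.card_erase_of_mem ha]; omega
  have hle := symmIdeal_erase_le (K := K) (r := d + 1) hm ha subset_rfl
  refine (eq_of_hilbertSeries_eq (homIdeal_symmIdeal.sup
    (homIdeal_span_singleton (MvPolynomial.isHomogeneous_X K a))) hle ?_).symm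
  have h1 := hilbertSeries_le_of_pow_mem (MvPolynomial.isHomogeneous_X K a) _ homIdeal_symmIdeal
    (X_pow_mem_symmIdeal (u := sᶜ) (r := d + 1) hm ha)
  have h2 := CoeffLE.mul_left (zero_le_geomSeries 1 ((d + 1) * m)) (hilbertSeries_mono hle)
  rw [hilbertSeries_symmIdeal hm hs'] at h2 ⊢
  rw [h] at h1
  exact mul_left_cancel₀ (geomSeries_ne_zero 1 (by positivity)) (h1.antisymm h2)

/-- The two end bounds add up to the known series of the middle term, so each is attained and the
inclusions behind them are equalities. -/
theorem symmIdeal_exact (hm : 1 ≤ m) (ha : a ∈ s) {d c : ℕ} (hs : s.card = c + d + 2) :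
    symmIdeal K m sᶜ s s (d + 2) ⊔ Ideal.span {MvPolynomial.X a} =
      symmIdeal K m (s.erase a)ᶜ (s.erase a) (s.erase a) (d + 2) ∧
    colonBy (symmIdeal K m sᶜ s s (d + 2)) (MvPolynomial.X a) =
      symmIdeal K m sᶜ (s.erase a) s (d + 1) ∧
    hilbertSeries (symmIdeal K m sᶜ (s.erase a) s (d + 1)) =
      geomSeries 1 ((d + 1) * m) * symmSeries m (c + 1) d := by
  have hs' : (s.erase a).card = c + (d + 1) := by rw [Finset.card_erase_of_mem ha]; omega
  have hX := MvPolynomial.isHomogeneous_X K a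
  have h1 := symmIdeal_erase_le (K := K) (r := d + 2) hm ha (Finset.erase_subset a s)
  have h2 := symmIdeal_le_colonBy (K := K) (m := m) (r := d + 1) ha
  have h3 := hilbertSeries_symmIdeal_erase_le (K := K) (d := d) hm ha
    (hilbertSeries_symmIdeal_le hm d (c + 1) (by omega))
  have h4 := hilbertSeries_eq_add (K := K) (homIdeal_symmIdeal (m := m) (u := sᶜ) (v := s) (w := s)
    (r := d + 2)) hX
  rw [hilbertSeries_symmIdeal (c := c + 1) (d := d + 1) hm (by omega), symmSeries_succ_succ,
    ← hilbertSeries_symmIdeal (K := K) hm hs'] at h4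
  obtain ⟨h5, h6⟩ := CoeffLE.eq_of_add_eq (hilbertSeries_mono h1)
    (CoeffLE.mul_left (CoeffLE.zero_X_pow 1) ((hilbertSeries_mono h2).trans h3)) h4.symm
  have h7 := mul_left_cancel₀ (pow_ne_zero 1 PowerSeries.X_ne_zero) h6
  have h8 := h3.antisymm (h7 ▸ hilbertSeries_mono h2)
  exact ⟨(eq_of_hilbertSeries_eq (homIdeal_symmIdeal.sup (homIdeal_span_singleton hX)) h1
    h5.symm).symm, (eq_of_hilbertSeries_eq (homIdeal_symmIdeal.colonBy hX) h2
    (h8.trans h7.symm)).symm, h8⟩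

end

/-! ### Closed form of the recursive series -/

/-- The Hilbert series of the complete intersection of degrees `m, 2 m, …, d m`, without the
contribution of its variables. -/
noncomputable def geomProd (m d : ℕ) : ℚ⟦X⟧ := ∏ j ∈ Finset.range d, geomSeries 1 ((j + 1) * m)

theorem geomProd_succ (m d : ℕ) :
    geomProd m (d + 1) = geomSeries 1 ((d + 1) * m) * geomProd m d := by
  rw [geomProd, Finset.prod_range_succ, mul_comm, geomProd]

theorem symmSeries_zero_left (m d : ℕ) : symmSeries m 0 d = geomProd m d := by
  induction d with
  | zero => simp [symmSeries_zero_right, geomProd]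
  | succ d ih => rw [symmSeries_zero_succ, geomProd_succ, ih]

/-- After the common product is factored out, the recursion in `c` is Pascal's rule for the
coefficients. -/
theorem symmSeries_succ_left (m d c : ℕ) : symmSeries m (c + 1) d =
    (∑ j ∈ Finset.range (d + 1), PowerSeries.C ((Nat.choose (c + j) c : ℕ) : ℚ) *
      (PowerSeries.X : ℚ⟦X⟧) ^ j) * geomProd m d := by
  induction d generalizing c with
  | zero => simp [symmSeries_zero_right, geomProd]
  | succ d ihd =>
    have hX (c : ℕ) : symmSeries m c (d + 1) + PowerSeries.X ^ 1 * (geomSeries 1 ((d + 1) * m) *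
        symmSeries m (c + 1) d) = symmSeries m c (d + 1) +
        (∑ j ∈ Finset.range (d + 1), PowerSeries.C ((Nat.choose (c + j) c : ℕ) : ℚ) *
      (PowerSeries.X : ℚ⟦X⟧) ^ (j + 1)) * geomProd m (d + 1) := by
      rw [ihd, geomProd_succ]
      simp_rw [pow_succ, ← mul_assoc, ← Finset.sum_mul]
      ring
    induction c with
    | zero =>
      rw [symmSeries_succ_succ, hX, symmSeries_zero_left, Finset.sum_range_succ' _ (d + 1), add_mul]
      simp [add_comm]
    | succ c ihc =>
      rw [symmSeries_succ_succ, hX, ihc, ← add_mul, Finset.sum_range_succ' _ (d + 1),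
        Finset.sum_range_succ' _ (d + 1), add_right_comm, ← Finset.sum_add_distrib]
      congr 2
      · refine Finset.sum_congr rfl fun j _ => ?_
        rw [← add_mul, ← map_add, ← Nat.cast_add, add_right_comm c 1 j, ← add_assoc,
          ← Nat.choose_succ_succ, ← add_assoc, add_right_comm c 1 j]
      · simp

/-- For c = 1 all binomials are 1, and (1 + ⋯ + t^d)(1 + t^(d+1) + ⋯ + t^((m-1)(d+1))) is the
missing factor. It compares A/C with A/(C + p), where p has degree d + 1 and p^m lies in C. -/
theorem symmSeries_zero_succ_eq (m d : ℕ) :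
    symmSeries m 0 (d + 1) = geomSeries (d + 1) m * symmSeries m 1 d := by
  have h : ∑ j ∈ Finset.range (d + 1), PowerSeries.C ((Nat.choose (0 + j) 0 : ℕ) : ℚ) *
      (PowerSeries.X : ℚ⟦X⟧) ^ j = geomSeries 1 (d + 1) := by
    simp [geomSeries]
  rw [symmSeries_zero_left, geomProd_succ, symmSeries_succ_left m d 0, h, geomSeries_mul, one_mul]
  ring

/-! ### The degree of the socle -/

section

variable {K : Type*} [Field K] {n : ℕ} {m : ℕ} {s : Finset (Fin n)} {a : Fin n}

/-- Every homogeneous element of degree different from `D` that is annihilated by all variables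
modulo `I` lies in `I`. -/
def SocleInDegree (I : Ideal (MvPolynomial (Fin n) K)) (D : ℕ) : Prop :=
  ∀ (f : MvPolynomial (Fin n) K) (e : ℕ), f.IsHomogeneous e → e ≠ D →
    (∀ k, MvPolynomial.X k * f ∈ I) → f ∈ I

/-- The alternative `f' = 0` covers e < k, where the natural subtraction `e - k` carries no
information. -/
theorem exists_isHomogeneous_sub_mul_mem {I : Ideal (MvPolynomial (Fin n) K)} (hI : HomIdeal I)
    {f g : MvPolynomial (Fin n) K} {e k : ℕ} (hf : f.IsHomogeneous e) (hg : g.IsHomogeneous k)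
    (h : f ∈ I ⊔ Ideal.span {g}) :
    ∃ f' : MvPolynomial (Fin n) K, f'.IsHomogeneous (e - k) ∧ (k ≤ e ∨ f' = 0) ∧
      f - g * f' ∈ I := by
  obtain ⟨a, ha, b, hb, hab⟩ := Submodule.mem_sup.mp h
  obtain ⟨c, rfl⟩ := Ideal.mem_span_singleton'.mp hb
  have h1 := congrArg (MvPolynomial.homogeneousComponent e) hab
  rw [map_add, mul_comm c, MvPolynomial.homogeneousComponent_eq_self hf] at h1
  rcases Nat.lt_or_ge e k with hk | hk
  · rw [homogeneousComponent_mul_of_lt hg hk, add_zero] at h1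
    refine ⟨0, MvPolynomial.isHomogeneous_zero _ _ _, Or.inr rfl, ?_⟩
    rw [mul_zero, sub_zero, ← h1]
    exact hI a ha e
  · obtain ⟨e, rfl⟩ := Nat.exists_eq_add_of_le hk
    rw [homogeneousComponent_mul_of_isHomogeneous hg] at h1
    refine ⟨MvPolynomial.homogeneousComponent e c, ?_, Or.inl hk, ?_⟩
    · rw [Nat.add_sub_cancel_left]
      exact MvPolynomial.homogeneousComponent_isHomogeneous e c
    · rw [← h1, add_sub_cancel_right]
      exact hI a ha _

/-- By `hs`, A/I behaves like a free module over K[x_a]/(x_a^(N+1)): every socle element is x_a^N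
times a lift of a socle element of A/(I + x_a), which raises the degree by N. -/
theorem SocleInDegree.of_sup_X {I : Ideal (MvPolynomial (Fin n) K)} (hI : HomIdeal I) {N D : ℕ}
    (hN : MvPolynomial.X a ^ (N + 1) ∈ I)
    (hs : hilbertSeries I =
      geomSeries 1 (N + 1) * hilbertSeries (I ⊔ Ideal.span {MvPolynomial.X a}))
    (h : SocleInDegree (I ⊔ Ideal.span {MvPolynomial.X a}) D) : SocleInDegree I (D + N) := by
  intro f e hf he hfI
  have hX := MvPolynomial.isHomogeneous_X K a
  have key : ∀ j ≤ N, f ∈ I ⊔ Ideal.span {MvPolynomial.X a ^ j} := by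
    intro j hj
    induction j with
    | zero =>
      rw [pow_zero, Ideal.span_singleton_one, sup_top_eq]
      trivial
    | succ j ih =>
      obtain ⟨b, hb, b', hb', rfl⟩ := Submodule.mem_sup.mp (ih (by omega))
      obtain ⟨c, rfl⟩ := Ideal.mem_span_singleton'.mp hb'
      -- Since x_a f ∈ I and f ≡ c x_a^j, multiplying by the remaining power of x_a kills c x_a^N;
      -- sharpness then gives c ∈ I + (x_a), which gains one more factor x_a.
      have h1 : MvPolynomial.X a ^ N * c ∈ I := by
        have h2 := Ideal.mul_mem_left I (MvPolynomial.X a ^ (N - (j + 1))) (hfI a)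
        have e1 : (MvPolynomial.X a : MvPolynomial (Fin n) K) ^ N =
            MvPolynomial.X a ^ (N - (j + 1)) * MvPolynomial.X a * MvPolynomial.X a ^ j := by
          rw [← pow_succ, ← pow_add]
          congr 1
          omega
        have e2 : MvPolynomial.X a ^ N * c = MvPolynomial.X a ^ (N - (j + 1)) *
            (MvPolynomial.X a * (b + c * MvPolynomial.X a ^ j)) -
            MvPolynomial.X a ^ (N - (j + 1)) * MvPolynomial.X a * b := by
          rw [e1]
          ring
        rw [e2]
        exact sub_mem h2 (Ideal.mul_mem_left _ _ hb)
      obtain ⟨u, hu, v, hv, rfl⟩ :=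
        Submodule.mem_sup.mp (mem_of_pow_mul_mem hX N hI hN hs h1)
      obtain ⟨w, rfl⟩ := Ideal.mem_span_singleton'.mp hv
      refine add_mem (Ideal.mem_sup_left hb) ?_
      rw [add_mul]
      refine add_mem (Ideal.mem_sup_left (Ideal.mul_mem_right _ _ hu)) (Ideal.mem_sup_right ?_)
      exact Ideal.mem_span_singleton'.mpr ⟨w, by ring⟩
  obtain ⟨f', hf', hN', hsub⟩ := exists_isHomogeneous_sub_mul_mem hI hf (hX.pow N) (key N le_rfl)
  rw [one_mul] at hf' hN'
  have hmem : MvPolynomial.X a ^ N * f' ∈ I := by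
    rcases hN' with hN' | rfl
    · have h1 := h f' (e - N) hf' (by omega) fun k => by
        refine mem_of_pow_mul_mem hX N hI hN hs ?_
        have e1 : MvPolynomial.X a ^ N * (MvPolynomial.X k * f') = MvPolynomial.X k * f -
            MvPolynomial.X k * (f - MvPolynomial.X a ^ N * f') := by ring
        rw [e1]
        exact sub_mem (hfI k) (Ideal.mul_mem_left _ _ hsub)
      obtain ⟨u, hu, v, hv, rfl⟩ := Submodule.mem_sup.mp h1
      obtain ⟨w, rfl⟩ := Ideal.mem_span_singleton'.mp hv
      have e1 : MvPolynomial.X a ^ N * (u + w * MvPolynomial.X a) =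
          MvPolynomial.X a ^ N * u + w * MvPolynomial.X a ^ (N + 1) := by ring
      rw [e1]
      exact add_mem (Ideal.mul_mem_left _ _ hu) (Ideal.mul_mem_left _ _ hN)
    · simp
  have := add_mem hsub hmem
  rwa [sub_add_cancel] at this

theorem SocleInDegree.symmIdeal_erase (hm : 1 ≤ m) (ha : a ∈ s) {d c D : ℕ}
    (hs : s.card = c + d + 1)
    (h : hilbertSeries (symmIdeal K m sᶜ (s.erase a) s (d + 1)) =
      geomSeries 1 ((d + 1) * m) * symmSeries m c d)
    (hD : SocleInDegree (symmIdeal K m (s.erase a)ᶜ (s.erase a) (s.erase a) (d + 1)) D) :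
    SocleInDegree (symmIdeal K m sᶜ (s.erase a) s (d + 1)) (D + ((d + 1) * m - 1)) := by
  have hpos : (d + 1) * m - 1 + 1 = (d + 1) * m :=
    Nat.sub_add_cancel (Nat.mul_pos d.succ_pos hm)
  have hsup := symmIdeal_erase_sup_eq hm ha hs h
  refine SocleInDegree.of_sup_X (a := a) homIdeal_symmIdeal ?_ ?_ (hsup ▸ hD)
  · rw [hpos]
    exact X_pow_mem_symmIdeal hm ha
  · rw [hpos, hsup, h, hilbertSeries_symmIdeal hm
      (show (s.erase a).card = c + d by rw [Finset.card_erase_of_mem ha]; omega)]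

theorem socleInDegree_zero {I : Ideal (MvPolynomial (Fin n) K)}
    (hI : ∀ k, MvPolynomial.X k ∈ I) : SocleInDegree I 0 :=
  fun _ _ hf he _ => mem_of_isHomogeneous_of_X_mem hI hf he

theorem socleInDegree_symmIdeal_of_card (hm : 1 ≤ m) (d : ℕ) {s : Finset (Fin n)}
    (hs : s.card = d) : SocleInDegree (symmIdeal K m sᶜ s s (d + 1))
      (∑ j ∈ Finset.range d, ((j + 1) * m - 1)) := by
  induction d generalizing s with
  | zero => exact socleInDegree_zero X_mem_symmIdeal_one
  | succ d ih =>
    obtain ⟨a, ha⟩ := Finset.card_pos.mp (show 0 < s.card by omega)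
    have e := symmIdeal_erase_eq_of_card (K := K) (m := m) hs ha
    rw [Finset.sum_range_succ, ← e]
    refine SocleInDegree.symmIdeal_erase (c := 0) hm ha (by omega) ?_
      (ih (by rw [Finset.card_erase_of_mem ha]; omega))
    rw [e, hilbertSeries_symmIdeal (c := 0) (d := d + 1) hm (by omega), symmSeries_zero_succ]

/-- Here J = C + (p) as in the overview. Multiplication by p^(m-1) carries socle elements of A/J to
socle elements of A/C, and it is injective because H(C) attains the bound for p^m ∈ C. -/
theorem socleInDegree_symmIdeal_of_card_succ (hm : 1 ≤ m) {d : ℕ} (hs : s.card = d + 1) :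
    SocleInDegree (symmIdeal K m sᶜ s s (d + 1)) (∑ j ∈ Finset.range d, (j + 1) * m) := by
  have hC := socleInDegree_symmIdeal_of_card (K := K) hm (d + 1) hs
  set C := symmIdeal K m sᶜ s s (d + 1 + 1) with hCdef
  have hChom : HomIdeal C := homIdeal_symmIdeal
  set p : MvPolynomial (Fin n) K := ∏ k ∈ s, MvPolynomial.X k with hp
  have hphom : p.IsHomogeneous (d + 1) := by
    have := MvPolynomial.IsHomogeneous.prod s (fun k => (MvPolynomial.X k : MvPolynomial (Fin n) K))
      (fun _ => 1) fun k _ => MvPolynomial.isHomogeneous_X K k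
    rwa [Finset.sum_const, smul_eq_mul, mul_one, hs] at this
  have hJ : symmIdeal K m sᶜ s s (d + 1) = C ⊔ Ideal.span {p} := by
    refine le_antisymm (symmIdeal_le_iff.mpr ⟨fun k hk => Ideal.mem_sup_left (X_mem_symmIdeal hk),
      fun T hT hr => ?_, fun j hj => Ideal.mem_sup_left (powEsymm_mem_symmIdeal hj)⟩)
      (sup_le (symmIdeal_le_iff.mpr ⟨fun k hk => X_mem_symmIdeal hk, fun T hT hr => ?_,
        fun j hj => powEsymm_mem_symmIdeal hj⟩) ?_)
    · rw [Finset.eq_of_subset_of_card_le hT (by omega)]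
      exact Ideal.mem_sup_right (Ideal.mem_span_singleton_self p)
    · have := Finset.card_le_card hT
      omega
    · rw [Ideal.span_singleton_le_iff_mem]
      exact prod_X_mem_symmIdeal subset_rfl hs
  have hsC : hilbertSeries C = geomSeries (d + 1) m * hilbertSeries (C ⊔ Ideal.span {p}) := by
    rw [← hJ, hilbertSeries_symmIdeal (c := 0) hm (by omega),
      hilbertSeries_symmIdeal (c := 1) hm (by omega), symmSeries_zero_succ_eq]
  have hpC : p ^ m ∈ C := by
    rw [hp, ← powEsymm_card]
    exact powEsymm_mem_symmIdeal (by omega)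
  -- The socle degree of A/C minus (m - 1)(d + 1), the degree of p^(m-1), is the claimed degree.
  have hsum : ∑ j ∈ Finset.range (d + 1), ((j + 1) * m - 1) + (d + 1) =
      ∑ j ∈ Finset.range (d + 1), (j + 1) * m := by
    have : ∑ j ∈ Finset.range (d + 1), ((j + 1) * m - 1) + (d + 1) =
        ∑ j ∈ Finset.range (d + 1), ((j + 1) * m - 1) + ∑ j ∈ Finset.range (d + 1), 1 := by simp
    rw [this, ← Finset.sum_add_distrib]
    exact Finset.sum_congr rfl fun j _ => Nat.sub_add_cancel (Nat.mul_pos j.succ_pos hm)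
  obtain ⟨N, rfl⟩ := Nat.exists_eq_add_of_le' hm
  rw [hJ]
  intro f e hf he hfI
  refine mem_of_pow_mul_mem hphom N hChom hpC hsC (hC _ _ ((hphom.pow N).mul hf) ?_ fun k => ?_)
  · rw [Finset.sum_range_succ (fun j => (j + 1) * (N + 1)) d] at hsum
    have : (d + 1) * (N + 1) = (d + 1) * N + (d + 1) := by ring
    omega
  · obtain ⟨u, hu, v, hv, huv⟩ := Submodule.mem_sup.mp (hfI k)
    obtain ⟨w, rfl⟩ := Ideal.mem_span_singleton'.mp hv
    have e1 : MvPolynomial.X k * (p ^ N * f) = p ^ N * u + w * p ^ (N + 1) := by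
      linear_combination -p ^ N * huv
    rw [e1]
    exact add_mem (Ideal.mul_mem_left _ _ hu) (Ideal.mul_mem_left _ _ hpC)

/-- A socle element in the wrong degree vanishes modulo x_a by induction on `c`, hence is x_a f';
then f' is a socle element modulo J : x_a = L, handled by induction on `d`. -/
theorem socleInDegree_symmIdeal (hm : 1 ≤ m) (d c : ℕ) {s : Finset (Fin n)}
    (hs : s.card = c + 1 + d) : SocleInDegree (symmIdeal K m sᶜ s s (d + 1))
      (∑ j ∈ Finset.range d, (j + 1) * m) := by
  induction d generalizing c s with
  | zero => exact socleInDegree_zero X_mem_symmIdeal_one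
  | succ d ihd =>
    induction c generalizing s with
    | zero => exact socleInDegree_symmIdeal_of_card_succ hm (by omega)
    | succ c ihc =>
      obtain ⟨a, ha⟩ := Finset.card_pos.mp (show 0 < s.card by omega)
      have hcard := Finset.card_erase_of_mem ha
      obtain ⟨h1, h2, h3⟩ := symmIdeal_exact (K := K) (c := c + 1) (d := d) hm ha (by omega)
      have hL := SocleInDegree.symmIdeal_erase hm ha (by omega) h3 (ihd (c + 1) (by omega))
      intro f e hf he hfI
      have hX := MvPolynomial.isHomogeneous_X K a
      have hf1 := ihc (by omega) f e hf he fun k => h1 ▸ Ideal.mem_sup_left (hfI k)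
      rw [← h1] at hf1
      obtain ⟨f', hf', h1e, hsub⟩ := exists_isHomogeneous_sub_mul_mem homIdeal_symmIdeal hf hX hf1
      have hmem : MvPolynomial.X a * f' ∈ symmIdeal K m sᶜ s s (d + 1 + 1) := by
        rcases h1e with h1e | rfl
        · rw [← mem_colonBy]
          rw [h2]
          -- The socle of A/L sits in degree one less than the target, exactly offset by the factor
          -- x_a.
          refine hL f' (e - 1) hf' ?_ fun k => ?_
          · have := Nat.mul_pos d.succ_pos hm
            rw [Finset.sum_range_succ] at he
            rw [Nat.succ_eq_add_one] at this
            omega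
          · rw [← h2, mem_colonBy]
            have e1 : MvPolynomial.X a * (MvPolynomial.X k * f') = MvPolynomial.X k * f -
              MvPolynomial.X k * (f - MvPolynomial.X a * f') := by ring
            rw [e1]
            exact sub_mem (hfI k) (Ideal.mul_mem_left _ _ hsub)
        · simp
      have := add_mem hsub hmem
      rwa [sub_add_cancel] at this

end

/-! ### The socle as the top graded component -/

section

variable {K : Type*} [Field K] {n : ℕ}

theorem moduleSocle_eq_gradedPart {I : Ideal (MvPolynomial (Fin n) K)} (hI : HomIdeal I) {D : ℕ}
    (h : SocleInDegree I D) (htop : ∀ d, D < d → gradedPart I d = ⊥) :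
    (moduleSocle (MvPolynomial (Fin n) K) (MvPolynomial (Fin n) K ⧸ I)).restrictScalars K =
      gradedPart I D := by
  have hmem : ∀ (f : MvPolynomial (Fin n) K) (d : ℕ), f.IsHomogeneous d → D < d → f ∈ I := by
    intro f d hf hd
    have h1 : Ideal.Quotient.mk I f ∈ gradedPart I d := mem_gradedPart_iff.mpr ⟨f, hf, rfl⟩
    rw [htop d hd, Submodule.mem_bot] at h1
    exact Ideal.Quotient.eq_zero_iff_mem.mp h1
  have hsmul : ∀ f g : MvPolynomial (Fin n) K,
      f • Ideal.Quotient.mk I g = Ideal.Quotient.mk I (f * g) := fun f g => rfl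
  apply le_antisymm
  · let W : Submodule (MvPolynomial (Fin n) K) (MvPolynomial (Fin n) K ⧸ I) :=
      ⨅ k : Fin n, LinearMap.ker (LinearMap.lsmul (MvPolynomial (Fin n) K)
        (MvPolynomial (Fin n) K ⧸ I) (MvPolynomial.X k))
    have hW : moduleSocle (MvPolynomial (Fin n) K) (MvPolynomial (Fin n) K ⧸ I) ≤ W := by
      refine sSup_le fun S hS => le_iInf fun k q hq => ?_
      have : IsSimpleModule (MvPolynomial (Fin n) K) S := hS
      let φ : S →ₗ[MvPolynomial (Fin n) K] S :=
        LinearMap.lsmul (MvPolynomial (Fin n) K) S (MvPolynomial.X k)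
      have hφ : φ = 0 := by
        -- Schur's lemma: a variable acts on a simple submodule bijectively or by zero, and
        -- bijectivity is impossible as its power `D + 1` lies in I.
        refine (LinearMap.bijective_or_eq_zero φ).resolve_left fun hb => ?_
        have hpow : ∀ (N : ℕ) (x : S), (φ^[N]) x = (MvPolynomial.X k ^ N : MvPolynomial (Fin n) K) • x := by
          intro N x
          induction N with
          | zero => simp
          | succ N ih =>
            rw [Function.iterate_succ_apply', ih, pow_succ', mul_smul]
            rfl
        have hinj := hb.1.iterate (D + 1)
        have := IsSimpleModule.nontrivial (MvPolynomial (Fin n) K) S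
        obtain ⟨x, hx⟩ := exists_ne (0 : S)
        refine hx (hinj ?_)
        rw [hpow, hpow, smul_zero]
        ext
        obtain ⟨g, hg⟩ := Ideal.Quotient.mk_surjective (x : MvPolynomial (Fin n) K ⧸ I)
        rw [Submodule.coe_smul, ← hg, hsmul, Submodule.coe_zero, Ideal.Quotient.eq_zero_iff_mem]
        exact Ideal.mul_mem_right _ _
          (hmem _ _ (MvPolynomial.isHomogeneous_X_pow k (D + 1)) (by omega))
      have h1 : φ ⟨q, hq⟩ = 0 := by rw [hφ]; rfl
      exact congrArg Subtype.val h1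
    intro q hq
    have hq1 : q ∈ W := hW hq
    obtain ⟨f, rfl⟩ := Ideal.Quotient.mk_surjective q
    have hf : ∀ k, MvPolynomial.X k * f ∈ I := fun k => by
      have h1 : (MvPolynomial.X k : MvPolynomial (Fin n) K) • Ideal.Quotient.mk I f = 0 :=
        (Submodule.mem_iInf _).mp hq1 k
      rwa [hsmul, Ideal.Quotient.eq_zero_iff_mem] at h1
    rw [mem_gradedPart_iff]
    refine ⟨MvPolynomial.homogeneousComponent D f,
      MvPolynomial.homogeneousComponent_isHomogeneous D f, ?_⟩
    rw [eq_comm, Ideal.Quotient.mk_eq_mk_iff_sub_mem]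
    refine mem_of_homogeneousComponent_mem fun e => ?_
    rw [map_sub, MvPolynomial.homogeneousComponent_of_mem
      (MvPolynomial.homogeneousComponent_isHomogeneous D f)]
    split_ifs with he
    · rw [he, sub_self]
      exact zero_mem _
    · rw [sub_zero]
      refine h _ e (MvPolynomial.homogeneousComponent_isHomogeneous e f) he fun k => ?_
      rw [← homogeneousComponent_mul_of_isHomogeneous (MvPolynomial.isHomogeneous_X K k)]
      exact hI _ (hf k) _
  · intro q hq
    obtain ⟨f, hf, rfl⟩ := mem_gradedPart_iff.mp hq
    by_cases h0 : Ideal.Quotient.mk I f = 0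
    · rw [h0]
      exact zero_mem _
    -- A polynomial acts on a degree `D` element through its constant term, so a nonzero such
    -- element spans a one-dimensional, hence simple, submodule.
    have hX : ∀ g : MvPolynomial (Fin n) K, g * f - MvPolynomial.C (MvPolynomial.coeff 0 g) * f ∈ I := by
      intro g
      conv => enter [2, 1, 1]; rw [← MvPolynomial.sum_homogeneousComponent g,
        Finset.sum_range_succ', MvPolynomial.homogeneousComponent_zero]
      rw [add_mul, add_sub_cancel_right, Finset.sum_mul]
      refine sum_mem fun e _ => ?_
      exact hmem _ _ ((MvPolynomial.homogeneousComponent_isHomogeneous (e + 1) g).mul hf) (by omega)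
    let S := Submodule.span (MvPolynomial (Fin n) K) {Ideal.Quotient.mk I f}
    have hS : IsSimpleModule (MvPolynomial (Fin n) K) S := by
      rw [isSimpleModule_iff_toSpanSingleton_surjective]
      refine ⟨⟨⟨⟨_, Submodule.mem_span_singleton_self _⟩, 0, fun h => h0 (congrArg Subtype.val h)⟩⟩,
        ?_⟩
      rintro ⟨x, hx⟩ hx0 ⟨y, hy⟩
      obtain ⟨g, rfl⟩ := Submodule.mem_span_singleton.mp hx
      obtain ⟨g', rfl⟩ := Submodule.mem_span_singleton.mp hy
      have hg : MvPolynomial.coeff 0 g ≠ 0 := by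
        intro hg
        have h1 := hX g
        rw [hg, map_zero, zero_mul, sub_zero, ← Ideal.Quotient.eq_zero_iff_mem, ← hsmul] at h1
        exact hx0 (Subtype.ext h1)
      refine ⟨g' * MvPolynomial.C (MvPolynomial.coeff 0 g)⁻¹, Subtype.ext ?_⟩
      change (g' * MvPolynomial.C (MvPolynomial.coeff 0 g)⁻¹) • g • Ideal.Quotient.mk I f =
        g' • Ideal.Quotient.mk I f
      rw [hsmul, hsmul, hsmul, Ideal.Quotient.mk_eq_mk_iff_sub_mem]
      have h1 := Ideal.mul_mem_left I (g' * MvPolynomial.C (MvPolynomial.coeff 0 g)⁻¹) (hX g)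
      have h2 : (MvPolynomial.C (MvPolynomial.coeff 0 g)⁻¹ : MvPolynomial (Fin n) K) *
          MvPolynomial.C (MvPolynomial.coeff 0 g) = 1 := by
        rw [← map_mul, inv_mul_cancel₀ hg, map_one]
      have h3 : g' * MvPolynomial.C (MvPolynomial.coeff 0 g)⁻¹ * (g * f) - g' * f =
          g' * MvPolynomial.C (MvPolynomial.coeff 0 g)⁻¹ *
            (g * f - MvPolynomial.C (MvPolynomial.coeff 0 g) * f) := by
        linear_combination g' * f * h2
      rw [h3]
      exact h1
    have hle : S ≤ moduleSocle (MvPolynomial (Fin n) K) (MvPolynomial (Fin n) K ⧸ I) :=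
      le_sSup hS
    exact hle (Submodule.mem_span_singleton_self _)

theorem idealJ'_eq_symmIdeal (m i : ℕ) : idealJ' K n m i =
    symmIdeal K m (Finset.univ : Finset (Fin n))ᶜ Finset.univ Finset.univ i := by
  have he (j : ℕ) : MvPolynomial.aeval
      (fun k : Fin n => (MvPolynomial.X k : MvPolynomial (Fin n) K) ^ m)
      (MvPolynomial.esymm (Fin n) K j) = powEsymm K m Finset.univ j := by
    simp [MvPolynomial.esymm, powEsymm, map_sum, map_prod]
  apply le_antisymm
  · rw [idealJ', Ideal.span_le]
    rintro f (⟨j, hj, rfl⟩ | ⟨S, hS, rfl⟩)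
    · rw [he]
      exact powEsymm_mem_symmIdeal (Finset.mem_Icc.mp hj).1
    · exact prod_X_mem_symmIdeal (Finset.subset_univ S) hS
  · refine symmIdeal_le_iff.mpr ⟨fun k hk => by simp at hk, fun T _ hT =>
      Ideal.subset_span (Or.inr ⟨T, hT, rfl⟩), fun j hj => ?_⟩
    by_cases hn : j ≤ n
    · exact Ideal.subset_span (Or.inl ⟨j, Finset.mem_Icc.mpr ⟨hj, hn⟩, (he j).symm⟩)
    · rw [powEsymm, Finset.powersetCard_eq_empty.mpr (by simpa using hn), Finset.sum_empty]
      exact zero_mem _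

end

/-! ### The top coefficient and the main theorem -/

theorem geomSeries_one_left (N : ℕ) :
    geomSeries 1 N = (1 - PowerSeries.X ^ N) * (1 - PowerSeries.X : ℚ⟦X⟧)⁻¹ := by
  have h := geomSeries_mul_one_sub 1 N
  rw [pow_one, one_mul] at h
  rw [← h, mul_assoc, PowerSeries.mul_inv_cancel _ (by simp), mul_one]

/-- A polynomial representing `geomProd m d`, with its degree and leading coefficient. -/
theorem exists_monic_coe_eq_geomProd {m : ℕ} (hm : 1 ≤ m) (d : ℕ) :
    ∃ P : Polynomial ℚ, (P : ℚ⟦X⟧) = geomProd m d ∧ P.Monic ∧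
      P.natDegree + d = ∑ j ∈ Finset.range d, (j + 1) * m := by
  induction d with
  | zero => exact ⟨1, by simp [geomProd], Polynomial.monic_one, by simp⟩
  | succ d ih =>
    obtain ⟨P, hP, hmon, hdeg⟩ := ih
    obtain ⟨N, hN⟩ := Nat.exists_eq_succ_of_ne_zero (show (d + 1) * m ≠ 0 by positivity)
    let Q : Polynomial ℚ := ∑ j ∈ Finset.range (N + 1), Polynomial.X ^ j
    have hQ : Q.Monic := Polynomial.monic_geom_sum_X N.succ_ne_zero
    have hQd : Q.natDegree = N := by
      have h1 : Q.natDegree ≤ N := Polynomial.natDegree_sum_le_of_forall_le _ _ fun j hj => by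
        rw [Polynomial.natDegree_X_pow]
        exact Nat.lt_succ_iff.mp (Finset.mem_range.mp hj)
      refine le_antisymm h1 (Polynomial.le_natDegree_of_ne_zero ?_)
      simp [Q, Polynomial.coeff_X_pow]
    refine ⟨Q * P, ?_, hQ.mul hmon, ?_⟩
    · rw [Polynomial.coe_mul, hP, geomProd_succ, hN]
      congr 1
      rw [geomSeries, Nat.succ_eq_add_one]
      ext e
      simp [Q, Polynomial.coeff_X_pow, PowerSeries.coeff_X_pow]
    · rw [hQ.natDegree_mul hmon, hQd, Finset.sum_range_succ, ← hdeg, hN]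
      omega

/-- The series is a monic polynomial times a binomial sum of degree at most d, so its top
coefficient is the last binomial coefficient. -/
theorem coeff_symmSeries {m : ℕ} (hm : 1 ≤ m) (d c : ℕ) :
    PowerSeries.coeff (∑ j ∈ Finset.range d, (j + 1) * m) (symmSeries m (c + 1) d) =
        (Nat.choose (c + d) c : ℚ) ∧
      ∀ e, ∑ j ∈ Finset.range d, (j + 1) * m < e →
        PowerSeries.coeff e (symmSeries m (c + 1) d) = 0 := by
  obtain ⟨P, hP, hmon, hdeg⟩ := exists_monic_coe_eq_geomProd hm d
  let Q : Polynomial ℚ := ∑ j ∈ Finset.range (d + 1),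
    Polynomial.C ((Nat.choose (c + j) c : ℕ) : ℚ) * Polynomial.X ^ j
  have hQd : Q.natDegree ≤ d := Polynomial.natDegree_sum_le_of_forall_le _ _ fun j hj =>
    (Polynomial.natDegree_C_mul_X_pow_le _ _).trans (Nat.lt_succ_iff.mp (Finset.mem_range.mp hj))
  have hQc : Q.coeff d = (Nat.choose (c + d) c : ℚ) := by
    simp [Q, Polynomial.coeff_X_pow]
  have hQP : symmSeries m (c + 1) d = ((P * Q : Polynomial ℚ) : ℚ⟦X⟧) := by
    rw [symmSeries_succ_left, Polynomial.coe_mul, hP, mul_comm]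
    congr 1
    ext e
    rw [Polynomial.coeff_coe, map_sum, Polynomial.finsetSum_coeff]
    refine Finset.sum_congr rfl fun j _ => ?_
    rw [PowerSeries.coeff_C_mul, Polynomial.coeff_C_mul, PowerSeries.coeff_X_pow,
      Polynomial.coeff_X_pow]
  rw [hQP]
  refine ⟨?_, fun e he => ?_⟩
  · rw [Polynomial.coeff_coe, ← hdeg, Polynomial.coeff_mul_add_eq_of_natDegree_le le_rfl hQd,
      hmon.coeff_natDegree, one_mul, hQc]
  · rw [Polynomial.coeff_coe]
    refine Polynomial.coeff_eq_zero_of_natDegree_lt (lt_of_le_of_lt Polynomial.natDegree_mul_le ?_)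
    omega

theorem mainTheorem3 (K : Type*) [Field K] (n m i : ℕ) (hm : 1 ≤ m) (hi : 1 ≤ i) (hin : i ≤ n) :
    -- the Hilbert series of `A / J'`
    hilbertSeries (idealJ' K n m i) =
      (∑ j ∈ Finset.range i,
          PowerSeries.C ((Nat.choose (n - i + j) (n - i) : ℕ) : ℚ) * (PowerSeries.X : ℚ⟦X⟧) ^ j) *
        ∏ j ∈ Finset.Icc 1 (i - 1),
          ((1 - (PowerSeries.X : ℚ⟦X⟧) ^ (j * m)) * (1 - (PowerSeries.X : ℚ⟦X⟧))⁻¹) ∧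
    -- the socle lies in the component of top degree, the largest degree that is nonzero in `A / J'`
    (∃ D : ℕ, IsGreatest {d : ℕ | gradedPart (idealJ' K n m i) d ≠ ⊥} D ∧
      (moduleSocle (MvPolynomial (Fin n) K)
          (MvPolynomial (Fin n) K ⧸ idealJ' K n m i)).restrictScalars K ≤
        gradedPart (idealJ' K n m i) D) ∧
    -- the dimension of the socle over `K`
    Module.finrank K
        ((moduleSocle (MvPolynomial (Fin n) K)
          (MvPolynomial (Fin n) K ⧸ idealJ' K n m i)).restrictScalars K) =
      Nat.choose (n - 1) (i - 1) := by
  obtain ⟨d, rfl⟩ := Nat.exists_eq_add_of_le' hi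
  obtain ⟨c, rfl⟩ := Nat.exists_eq_add_of_le' hin
  -- With i = d + 1 and n = c + d + 1, the first index of `symmSeries` is n - i + 1 = c + 1, never
  -- zero.
  have hcard : (Finset.univ : Finset (Fin (c + (d + 1)))).card = c + 1 + d := by
    rw [Finset.card_univ, Fintype.card_fin]
    omega
  rw [idealJ'_eq_symmIdeal]
  have hs := hilbertSeries_symmIdeal (K := K) hm hcard
  have hsoc := socleInDegree_symmIdeal (K := K) hm d c hcard
  set J := symmIdeal K m (Finset.univ : Finset (Fin (c + (d + 1))))ᶜ Finset.univ Finset.univ (d + 1)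
  obtain ⟨htop, hgt⟩ := coeff_symmSeries hm d c
  set D := ∑ j ∈ Finset.range d, (j + 1) * m
  have hrank (e : ℕ) : (Module.finrank K (gradedPart J e) : ℚ) =
      PowerSeries.coeff e (symmSeries m (c + 1) d) := by
    rw [← hs, hilbertSeries, PowerSeries.coeff_mk]
  have hD : Module.finrank K (gradedPart J D) = Nat.choose (c + d) c := by
    exact_mod_cast (hrank D).trans htop
  have hbot (e : ℕ) (he : D < e) : gradedPart J e = ⊥ := by
    have h1 := (hrank e).trans (hgt e he)
    exact Submodule.finrank_eq_zero.mp (by exact_mod_cast h1)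
  have heq := moduleSocle_eq_gradedPart homIdeal_symmIdeal hsoc hbot
  refine ⟨?_, ⟨D, ⟨fun h => ?_, fun e he => ?_⟩, heq.le⟩, ?_⟩
  · rw [hs, symmSeries_succ_left, Nat.add_sub_cancel, Nat.add_sub_cancel, geomProd]
    simp_rw [geomSeries_one_left]
    rw [Finset.range_eq_Ico d, Finset.prod_Ico_add' (fun j => (1 - (PowerSeries.X : ℚ⟦X⟧) ^ (j * m)) *
      (1 - (PowerSeries.X : ℚ⟦X⟧))⁻¹) 0 d 1, zero_add]
    rfl
  · rw [h, finrank_bot] at hD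
    exact (Nat.choose_pos (Nat.le_add_right c d)).ne hD
  · by_contra! hlt
    exact he (hbot e hlt)
  · rw [heq, hD]
    have h1 : c + (d + 1) - 1 = c + d := by omega
    rw [h1, Nat.add_sub_cancel, Nat.choose_symm_add]
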